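/- Let $G(V,E)$ be a finite simple graph with $n$ vertices. A \emph{greyscale} of $G$ is a map $f:V\to[0,1]$ that attains both values $0$ and $1$. Its \emph{gradation vector} is the vector of the numbers $|f(u)-f(v)|$, $\{u,v\}\in E$ (listed with multiplicity), sorted in decreasing order; gradation vectors are compared lexicographically. For a nonempty proper subset $V_c\subset V$, an \emph{incomplete $V_c$-greyscale} is a map $g:V_c\to[0,1]$, and a greyscale $f$ is \emph{compatible} with $g$ if $f(u)=g(u)$ for all $u\in V_c$. Theorem. There is an algorithm which, given a connected graph $G(V,E)$ with $n$ vertices and an incomplete $V_c$-greyscale $g$ of $G$ that attains neither $0$ nor $1$ and leaves at least two vertices uncoloured ($|V\setminus V_c|\ge 2$), computes a greyscale of $G$ compatible with $g$ whose gradation vector is minimum among the gradation vectors of all greyscales compatible with $g$. Its running time is polynomial, namely $O(n^6)$, counted in elementary operations of a real random access machine (exact real arithmetic and comparisons, and memory accesses, at unit cost). -/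

import Mathlib

/-! ### Greyscales, gradation vectors -/

/-- A greyscale: a map from the vertices to `[0,1]` that attains both `0` and `1`. -/
def IsGreyscale {V : Type*} (f : V → ℝ) : Prop :=
  (∀ v, f v ∈ Set.Icc (0 : ℝ) 1) ∧ (∃ v, f v = 0) ∧ (∃ v, f v = 1)

/-- An incomplete `Vc`-greyscale: `Vc` is a nonempty proper subset of the vertex set and `g` maps
`Vc` to `[0,1]` (the extreme tones need not be attained). -/
def IsIncompleteGreyscale {V : Type*} [Fintype V] (Vc : Finset V) (g : Vc → ℝ) : Prop :=
  Vc.Nonempty ∧ Vc ≠ Finset.univ ∧ ∀ u, g u ∈ Set.Icc (0 : ℝ) 1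

/-- `f` agrees with the prescribed tones `g` on `Vc`. -/
def IsCompatible {V : Type*} {Vc : Finset V} (g : Vc → ℝ) (f : V → ℝ) : Prop :=
  ∀ u : Vc, f u = g u

/-- The grey tone `|f u - f v|` of the edge `{u,v}`. -/
def edgeTone {V : Type*} (f : V → ℝ) : Sym2 V → ℝ :=
  Sym2.lift ⟨fun u v => |f u - f v|, fun u v => abs_sub_comm (f u) (f v)⟩

/-- The gradation vector: the tones of all edges (with multiplicity), in decreasing order.
Lists of reals are compared lexicographically by `<` and `≤`. -/
noncomputable def gradation {V : Type*} [Fintype V] [DecidableEq V]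
    (G : SimpleGraph V) [DecidableRel G.Adj] (f : V → ℝ) : List ℝ :=
  (G.edgeFinset.val.map (edgeTone f)).sort (· ≥ ·)

/-- `f` is a greyscale compatible with `g` whose gradation vector is minimum among the gradation
vectors of all greyscales compatible with `g`. -/
def IsMinCompatibleGreyscale {V : Type*} [Fintype V] [DecidableEq V]
    (G : SimpleGraph V) [DecidableRel G.Adj] {Vc : Finset V} (g : Vc → ℝ) (f : V → ℝ) : Prop :=
  IsGreyscale f ∧ IsCompatible g f ∧
    ∀ f' : V → ℝ, IsGreyscale f' → IsCompatible g f' → gradation G f ≤ gradation G f'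

/-! ### A real random access machine

Programs of a small imperative language with natural-number registers and arrays, real registers
and arrays, exact arithmetic and comparisons, and unit cost for every elementary operation.  There
is no rounding and no conversion from reals to natural numbers. A program is a finite object that
does not depend on the input. -/

namespace RealRAM

/-- The memory: registers and two-dimensional arrays, of natural numbers and of reals. -/
structure State where
  ireg : ℕ → ℕ
  iarr : ℕ → ℕ → ℕ → ℕ
  rreg : ℕ → ℝ
  rarr : ℕ → ℕ → ℕ → ℝ

/-- Natural-number expressions: numerals, registers, array entries, sums, truncated differences. -/
inductive IExp where
  | const (k : ℕ)
  | reg (x : ℕ)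
  | get (a : ℕ) (i j : IExp)
  | add (e₁ e₂ : IExp)
  | sub (e₁ e₂ : IExp)

/-- Real expressions: numerals, registers, array entries, values of natural-number expressions,
and the four arithmetic operations. -/
inductive RExp where
  | const (k : ℕ)
  | reg (x : ℕ)
  | get (a : ℕ) (i j : IExp)
  | ofNat (e : IExp)
  | add (e₁ e₂ : RExp)
  | sub (e₁ e₂ : RExp)
  | mul (e₁ e₂ : RExp)
  | div (e₁ e₂ : RExp)

/-- Tests. -/
inductive BExp where
  | ilt (e₁ e₂ : IExp)
  | rlt (e₁ e₂ : RExp)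
  | not (b : BExp)
  | and (b₁ b₂ : BExp)

/-- Programs. -/
inductive Prog where
  | skip
  | iset (x : ℕ) (e : IExp)
  | iput (a : ℕ) (i j e : IExp)
  | rset (x : ℕ) (e : RExp)
  | rput (a : ℕ) (i j : IExp) (e : RExp)
  | seq (p q : Prog)
  | ite (b : BExp) (p q : Prog)
  | while (b : BExp) (p : Prog)

/-- Value of a natural-number expression. -/
def IExp.eval (s : State) : IExp → ℕ
  | .const k => k
  | .reg x => s.ireg x
  | .get a i j => s.iarr a (i.eval s) (j.eval s)
  | .add e₁ e₂ => e₁.eval s + e₂.eval s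
  | .sub e₁ e₂ => e₁.eval s - e₂.eval s

/-- Cost of evaluating a natural-number expression: one unit for each node. -/
def IExp.cost : IExp → ℕ
  | .const _ => 1
  | .reg _ => 1
  | .get _ i j => i.cost + j.cost + 1
  | .add e₁ e₂ => e₁.cost + e₂.cost + 1
  | .sub e₁ e₂ => e₁.cost + e₂.cost + 1

/-- Value of a real expression (a quotient by zero evaluates to zero). -/
noncomputable def RExp.eval (s : State) : RExp → ℝ
  | .const k => (k : ℝ)
  | .reg x => s.rreg x
  | .get a i j => s.rarr a (i.eval s) (j.eval s)
  | .ofNat e => (e.eval s : ℝ)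
  | .add e₁ e₂ => e₁.eval s + e₂.eval s
  | .sub e₁ e₂ => e₁.eval s - e₂.eval s
  | .mul e₁ e₂ => e₁.eval s * e₂.eval s
  | .div e₁ e₂ => e₁.eval s / e₂.eval s

/-- Cost of evaluating a real expression: one unit for each node. -/
def RExp.cost : RExp → ℕ
  | .const _ => 1
  | .reg _ => 1
  | .get _ i j => i.cost + j.cost + 1
  | .ofNat e => e.cost + 1
  | .add e₁ e₂ => e₁.cost + e₂.cost + 1
  | .sub e₁ e₂ => e₁.cost + e₂.cost + 1
  | .mul e₁ e₂ => e₁.cost + e₂.cost + 1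
  | .div e₁ e₂ => e₁.cost + e₂.cost + 1

/-- Truth of a test. -/
def BExp.holds (s : State) : BExp → Prop
  | .ilt e₁ e₂ => e₁.eval s < e₂.eval s
  | .rlt e₁ e₂ => e₁.eval s < e₂.eval s
  | .not b => ¬ b.holds s
  | .and b₁ b₂ => b₁.holds s ∧ b₂.holds s

/-- Cost of a test: one unit for each node. -/
def BExp.cost : BExp → ℕ
  | .ilt e₁ e₂ => e₁.cost + e₂.cost + 1
  | .rlt e₁ e₂ => e₁.cost + e₂.cost + 1
  | .not b => b.cost + 1
  | .and b₁ b₂ => b₁.cost + b₂.cost + 1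

/-- Overwrite one natural-number register. -/
def State.iset (s : State) (x v : ℕ) : State :=
  { s with ireg := fun y => if y = x then v else s.ireg y }

/-- Overwrite one natural-number array entry. -/
def State.iput (s : State) (a i j v : ℕ) : State :=
  { s with iarr := fun a' i' j' => if a' = a ∧ i' = i ∧ j' = j then v else s.iarr a' i' j' }

/-- Overwrite one real register. -/
noncomputable def State.rset (s : State) (x : ℕ) (v : ℝ) : State :=
  { s with rreg := fun y => if y = x then v else s.rreg y }

/-- Overwrite one real array entry. -/
noncomputable def State.rput (s : State) (a i j : ℕ) (v : ℝ) : State :=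
  { s with rarr := fun a' i' j' => if a' = a ∧ i' = i ∧ j' = j then v else s.rarr a' i' j' }

/-- `Exec p s t k`: started in the memory `s`, the program `p` halts in the memory `t` after `k`
elementary operations. -/
inductive Exec : Prog → State → State → ℕ → Prop
  | skip (s : State) : Exec .skip s s 1
  | iset (s : State) (x : ℕ) (e : IExp) :
      Exec (.iset x e) s (s.iset x (e.eval s)) (e.cost + 1)
  | iput (s : State) (a : ℕ) (i j e : IExp) :
      Exec (.iput a i j e) s (s.iput a (i.eval s) (j.eval s) (e.eval s))
        (i.cost + j.cost + e.cost + 1)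
  | rset (s : State) (x : ℕ) (e : RExp) :
      Exec (.rset x e) s (s.rset x (e.eval s)) (e.cost + 1)
  | rput (s : State) (a : ℕ) (i j : IExp) (e : RExp) :
      Exec (.rput a i j e) s (s.rput a (i.eval s) (j.eval s) (e.eval s))
        (i.cost + j.cost + e.cost + 1)
  | seq {p q : Prog} {s t u : State} {k l : ℕ} (hp : Exec p s t k) (hq : Exec q t u l) :
      Exec (.seq p q) s u (k + l)
  | ite_true {b : BExp} {p q : Prog} {s t : State} {k : ℕ} (hb : b.holds s)
      (hp : Exec p s t k) : Exec (.ite b p q) s t (b.cost + 1 + k)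
  | ite_false {b : BExp} {p q : Prog} {s t : State} {k : ℕ} (hb : ¬ b.holds s)
      (hq : Exec q s t k) : Exec (.ite b p q) s t (b.cost + 1 + k)
  | while_true {b : BExp} {p : Prog} {s t u : State} {k l : ℕ} (hb : b.holds s)
      (hp : Exec p s t k) (hw : Exec (.while b p) t u l) :
      Exec (.while b p) s u (b.cost + 1 + k + l)
  | while_false {b : BExp} {p : Prog} {s : State} (hb : ¬ b.holds s) :
      Exec (.while b p) s s (b.cost + 1)

/-- The initial memory for a graph on the vertices `0, …, n - 1` with prescribed tones `g` on `Vc`.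
Natural-number register `0` holds `n`; natural-number array `0` is the adjacency matrix;
natural-number array `1` marks the elements `i` of `Vc` at position `(i,0)`; real array `0`
holds the tone of each `i ∈ Vc` at position `(i,0)`. All other cells are `0`. -/
noncomputable def input {n : ℕ} (G : SimpleGraph (Fin n)) [DecidableRel G.Adj]
    (Vc : Finset (Fin n)) (g : Vc → ℝ) : State where
  ireg x := if x = 0 then n else 0
  iarr a i j :=
    if a = 0 then
      if h : i < n ∧ j < n then (if G.Adj ⟨i, h.1⟩ ⟨j, h.2⟩ then 1 else 0) else 0
    else if a = 1 ∧ j = 0 then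
      if h : i < n then (if (⟨i, h⟩ : Fin n) ∈ Vc then 1 else 0) else 0
    else 0
  rreg _ := 0
  rarr a i j :=
    if a = 0 ∧ j = 0 then
      if h : i < n then (if hc : (⟨i, h⟩ : Fin n) ∈ Vc then g ⟨⟨i, h⟩, hc⟩ else 0) else 0
    else 0

/-- The output: the tone of vertex `i` is read at position `(i,0)` of real array `1`. -/
def output (n : ℕ) (t : State) : Fin n → ℝ := fun i => t.rarr 1 i 0

end RealRAM

/-! Since `g` avoids the values 0 and 1, every compatible greyscale attains both of them outside
`Vc`. It therefore suffices to treat each ordered pair of distinct uncoloured vertices, give them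
the tones 0 and 1, extend optimally, and keep the best result. Two uncoloured vertices guarantee
that at least one pair is treated.

For a fixed pair the optimal extension is greedy. Let `F` be the current partial colouring of `T`.
Among the walks of at least two edges that join coloured vertices through uncoloured ones, take one
of maximal slope `a` (rise divided by length), say from `u` through its first inner vertex `w` to
`v`, and give `w` the tone `F u + a`. This creates no walk steeper than `a`: a walk starting or
ending at `w` can be completed by a piece of the chosen one to a walk that existed before
(`IsSteepest.sub_le`). Hence the slopes never increase, and in the end every edge not inside `T` has
tone at most `a`. An extension `f` that gives `w` another tone cannot rise by at most `a` on every
edge of the chosen walk, so some edge not inside `T` has a tone above `a`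
(`IsSteepest.worse_of_ne`). The two colourings agree on `T`, so `f` is lexicographically worse. The
predicate `Worse` stores this evidence; it survives later rounds (`IsSteepest.worse_mono`) and
finally yields a strict comparison (`toneLt_of_worse`). Thus every competitor equals the greedy
colouring or loses strictly.

As the maximal slope is nonnegative, only shortest walks from `w` to `v` matter. They come from
Floyd-Warshall with uncoloured intermediate vertices (`floydWarshall_run`) in time `n^3`; scanning
all triples `u`, `w`, `v` also costs `n^3`, and there are `n` rounds. Two gradation vectors are
compared by counting the multiplicity of each occurring squared tone, in time `n^4`; squares avoid
absolute values, and no sorting is needed. Over `n^2` pairs this gives `n^6`. All loops are counting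
loops up to `n`, so the running time is a constant times `n` to the nesting depth (`exec_toProg`),
which is six. -/

/-! ### Programs with bounded loops and their running time -/

namespace RealRAM

/-- Programs whose only loops are counting loops: `loop x p` runs `p` for `x = 0, …, n - 1`, where
`n` is the content of natural-number register `0`. -/
inductive Cmd where
  | skip
  | iset (x : ℕ) (e : IExp)
  | iput (a : ℕ) (i j e : IExp)
  | rset (x : ℕ) (e : RExp)
  | rput (a : ℕ) (i j : IExp) (e : RExp)
  | seq (p q : Cmd)
  | ite (b : BExp) (p q : Cmd)
  | loop (x : ℕ) (p : Cmd)

namespace Cmd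

/-- Compilation of counting loops to while loops. -/
def toProg : Cmd → Prog
  | skip => .skip
  | iset x e => .iset x e
  | iput a i j e => .iput a i j e
  | rset x e => .rset x e
  | rput a i j e => .rput a i j e
  | seq p q => .seq p.toProg q.toProg
  | ite b p q => .ite b p.toProg q.toProg
  | loop x p => .seq (.iset x (.const 0))
      (.while (.ilt (.reg x) (.reg 0)) (.seq p.toProg (.iset x (.add (.reg x) (.const 1)))))

open Classical in
/-- The memory after the execution of a program. -/
noncomputable def run : Cmd → State → State
  | skip => fun s => s
  | iset x e => fun s => s.iset x (e.eval s)
  | iput a i j e => fun s => s.iput a (i.eval s) (j.eval s) (e.eval s)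
  | rset x e => fun s => s.rset x (e.eval s)
  | rput a i j e => fun s => s.rput a (i.eval s) (j.eval s) (e.eval s)
  | seq p q => fun s => q.run (p.run s)
  | ite b p q => fun s => if b.holds s then p.run s else q.run s
  | loop x p => fun s => (fun t => (p.run t).iset x (t.ireg x + 1))^[s.ireg 0] (s.iset x 0)

theorem run_ite_pos {b : BExp} {s : State} (p q : Cmd) (h : b.holds s) :
    (ite b p q).run s = p.run s := if_pos h

theorem run_ite_neg {b : BExp} {s : State} (p q : Cmd) (h : ¬ b.holds s) :
    (ite b p q).run s = q.run s := if_neg h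

/-- Does the program assign the given natural-number register? -/
def writesIReg : Cmd → ℕ → Bool
  | iset x _, y => y == x
  | seq p q, y => p.writesIReg y || q.writesIReg y
  | ite _ p q, y => p.writesIReg y || q.writesIReg y
  | loop x p, y => y == x || p.writesIReg y
  | _, _ => false

/-- Does the program assign an entry of the given natural-number array? -/
def writesIArr : Cmd → ℕ → Bool
  | iput a _ _ _, y => y == a
  | seq p q, y => p.writesIArr y || q.writesIArr y
  | ite _ p q, y => p.writesIArr y || q.writesIArr y
  | loop _ p, y => p.writesIArr y
  | _, _ => false

/-- Does the program assign the given real register? -/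
def writesRReg : Cmd → ℕ → Bool
  | rset x _, y => y == x
  | seq p q, y => p.writesRReg y || q.writesRReg y
  | ite _ p q, y => p.writesRReg y || q.writesRReg y
  | loop _ p, y => p.writesRReg y
  | _, _ => false

/-- Does the program assign an entry of the given real array? -/
def writesRArr : Cmd → ℕ → Bool
  | rput a _ _ _, y => y == a
  | seq p q, y => p.writesRArr y || q.writesRArr y
  | ite _ p q, y => p.writesRArr y || q.writesRArr y
  | loop _ p, y => p.writesRArr y
  | _, _ => false

/-- No loop body assigns the loop counter or the loop bound. -/
def wf : Cmd → Bool
  | seq p q => p.wf && q.wf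
  | ite _ p q => p.wf && q.wf
  | loop x p => x != 0 && !p.writesIReg 0 && !p.writesIReg x && p.wf
  | _ => true

/-- The nesting depth of the loops. -/
def depth : Cmd → ℕ
  | seq p q => max p.depth q.depth
  | ite _ p q => max p.depth q.depth
  | loop _ p => p.depth + 1
  | _ => 0

/-- The constant in the bound for the running time. -/
def weight : Cmd → ℕ
  | skip => 1
  | iset _ e => e.cost + 1
  | iput _ i j e => i.cost + j.cost + e.cost + 1
  | rset _ e => e.cost + 1
  | rput _ i j e => i.cost + j.cost + e.cost + 1
  | seq p q => p.weight + q.weight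
  | ite b p q => b.cost + 1 + (p.weight + q.weight)
  | loop _ p => p.weight + 14

/-- The memories `s` and `t` agree on everything that `c` does not write. -/
structure Agree (c : Cmd) (s t : State) : Prop where
  ireg : ∀ y, c.writesIReg y = false → t.ireg y = s.ireg y
  iarr : ∀ a, c.writesIArr a = false → t.iarr a = s.iarr a
  rreg : ∀ y, c.writesRReg y = false → t.rreg y = s.rreg y
  rarr : ∀ a, c.writesRArr a = false → t.rarr a = s.rarr a

theorem Agree.refl (c : Cmd) (s : State) : Agree c s s :=
  ⟨fun _ _ => rfl, fun _ _ => rfl, fun _ _ => rfl, fun _ _ => rfl⟩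

theorem Agree.trans {c : Cmd} {s t u : State} (h : Agree c s t) (h' : Agree c t u) :
    Agree c s u :=
  ⟨fun y hy => (h'.ireg y hy).trans (h.ireg y hy), fun y hy => (h'.iarr y hy).trans (h.iarr y hy),
    fun y hy => (h'.rreg y hy).trans (h.rreg y hy), fun y hy => (h'.rarr y hy).trans (h.rarr y hy)⟩

theorem Agree.of_imp {c d : Cmd} {s t : State} (h : Agree c s t)
    (h₁ : ∀ y, d.writesIReg y = false → c.writesIReg y = false)
    (h₂ : ∀ y, d.writesIArr y = false → c.writesIArr y = false)
    (h₃ : ∀ y, d.writesRReg y = false → c.writesRReg y = false)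
    (h₄ : ∀ y, d.writesRArr y = false → c.writesRArr y = false) : Agree d s t :=
  ⟨fun y hy => h.ireg y (h₁ y hy), fun y hy => h.iarr y (h₂ y hy),
    fun y hy => h.rreg y (h₃ y hy), fun y hy => h.rarr y (h₄ y hy)⟩

theorem Agree.loop_iset {x : ℕ} {p : Cmd} (s : State) (v : ℕ) : Agree (loop x p) s (s.iset x v) := by
  refine ⟨fun y hy => ?_, fun _ _ => rfl, fun _ _ => rfl, fun _ _ => rfl⟩
  simp only [writesIReg, Bool.or_eq_false_iff, beq_eq_false_iff_ne] at hy
  simp [State.iset, hy.1]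

theorem Agree.loop_body {x : ℕ} {p : Cmd} {s t : State} (h : Agree p s t) :
    Agree (loop x p) s t := by
  apply h.of_imp <;> intro y hy <;>
    simp only [writesIReg, writesIArr, writesRReg, writesRArr, Bool.or_eq_false_iff] at hy <;> tauto

/-- Frame rule. The write checks are Boolean functions of the syntax, so for a concrete program
their side conditions hold by `rfl`. This is how untouched cells are carried past a subprogram. -/
theorem run_agree (c : Cmd) (s : State) : Agree c s (c.run s) := by
  induction c generalizing s with
  | skip => exact Agree.refl _ _
  | iset x e =>
    refine ⟨fun y hy => ?_, fun _ _ => rfl, fun _ _ => rfl, fun _ _ => rfl⟩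
    simp only [writesIReg, beq_eq_false_iff_ne] at hy
    simp [run, State.iset, hy]
  | iput a i j e =>
    refine ⟨fun _ _ => rfl, fun y hy => ?_, fun _ _ => rfl, fun _ _ => rfl⟩
    simp only [writesIArr, beq_eq_false_iff_ne] at hy
    simp [run, State.iput, hy]
  | rset x e =>
    refine ⟨fun _ _ => rfl, fun _ _ => rfl, fun y hy => ?_, fun _ _ => rfl⟩
    simp only [writesRReg, beq_eq_false_iff_ne] at hy
    simp [run, State.rset, hy]
  | rput a i j e =>
    refine ⟨fun _ _ => rfl, fun _ _ => rfl, fun _ _ => rfl, fun y hy => ?_⟩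
    simp only [writesRArr, beq_eq_false_iff_ne] at hy
    simp [run, State.rput, hy]
  | seq p q hp hq =>
    refine ((hp s).of_imp ?_ ?_ ?_ ?_).trans ((hq (p.run s)).of_imp ?_ ?_ ?_ ?_) <;> intro y hy <;>
      simp only [writesIReg, writesIArr, writesRReg, writesRArr, Bool.or_eq_false_iff] at hy <;>
      tauto
  | ite b p q hp hq =>
    by_cases hb : b.holds s
    · simp only [run, hb, if_true]
      refine (hp s).of_imp ?_ ?_ ?_ ?_ <;> intro y hy <;>
        simp only [writesIReg, writesIArr, writesRReg, writesRArr, Bool.or_eq_false_iff] at hy <;>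
        tauto
    · simp only [run, hb, if_false]
      refine (hq s).of_imp ?_ ?_ ?_ ?_ <;> intro y hy <;>
        simp only [writesIReg, writesIArr, writesRReg, writesRArr, Bool.or_eq_false_iff] at hy <;>
        tauto
  | loop x p hp =>
    have key : ∀ (m : ℕ) (t : State), Agree (loop x p) t
        ((fun t => (p.run t).iset x (t.ireg x + 1))^[m] t) := by
      intro m
      induction m with
      | zero => exact fun t => Agree.refl _ _
      | succ m ih =>
        intro t
        rw [Function.iterate_succ_apply]
        exact ((hp t).loop_body.trans (Agree.loop_iset _ _)).trans (ih _)
    exact (Agree.loop_iset s 0).trans (key _ _)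

theorem wf_loop {x : ℕ} {c : Cmd} (h : (loop x c).wf = true) :
    x ≠ 0 ∧ c.writesIReg 0 = false ∧ c.writesIReg x = false ∧ c.wf = true := by
  simpa [wf, and_assoc] using h

/-- Invariant rule for counting loops. -/
theorem run_loop_induct {x : ℕ} {c : Cmd} {s : State}
    (I : ℕ → State → Prop) (h0 : I 0 (s.iset x 0))
    (hs : ∀ i t, i < s.ireg 0 → Agree (loop x c) s t → t.ireg x = i → I i t →
      I (i + 1) ((c.run t).iset x (i + 1))) :
    I (s.ireg 0) ((loop x c).run s) := by
  -- The frame condition and the value of the counter are carried along with `I`, so that the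
  -- induction step may use both.
  have key : ∀ m, m ≤ s.ireg 0 →
      Agree (loop x c) s ((fun t => (c.run t).iset x (t.ireg x + 1))^[m] (s.iset x 0)) ∧
      ((fun t => (c.run t).iset x (t.ireg x + 1))^[m] (s.iset x 0)).ireg x = m ∧
      I m ((fun t => (c.run t).iset x (t.ireg x + 1))^[m] (s.iset x 0)) := by
    intro m
    induction m with
    | zero => exact fun _ => ⟨Agree.loop_iset _ _, by simp [State.iset], h0⟩
    | succ m ih =>
      intro hm
      obtain ⟨h1, h2, h3⟩ := ih (by omega)
      rw [Function.iterate_succ_apply']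
      set t := (fun t => (c.run t).iset x (t.ireg x + 1))^[m] (s.iset x 0)
      refine ⟨(h1.trans (c.run_agree t).loop_body).trans (Agree.loop_iset _ _), ?_, ?_⟩
      · simp [State.iset, h2]
      · simp only [h2]
        exact hs m t (by omega) h1 h2 h3
  exact (key _ le_rfl).2.2

/-- Rule for loops that establish a property for each value of the counter, where the properties
persist along a preorder `R` of memories. -/
theorem run_loop_cover {x : ℕ} {c : Cmd} {s : State}
    (V : State → Prop) (R : State → State → Prop) (K : ℕ → State → Prop)
    (htrans : ∀ t u v, R t u → R u v → R t v)
    (hVx : ∀ t v, V t → V (t.iset x v)) (hRx : ∀ t v, R t (t.iset x v))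
    (hKR : ∀ i t t', R t t' → K i t → K i t') (h0 : V s)
    (hs : ∀ i t, i < s.ireg 0 → Agree (loop x c) s t → t.ireg x = i → V t →
      V (c.run t) ∧ R t (c.run t) ∧ K i (c.run t)) :
    V ((loop x c).run s) ∧ R s ((loop x c).run s) ∧ ∀ i < s.ireg 0, K i ((loop x c).run s) := by
  refine run_loop_induct (fun m t => V t ∧ R s t ∧ ∀ i < m, K i t)
    ⟨hVx _ _ h0, hRx _ _, fun i hi => absurd hi (by omega)⟩ ?_
  rintro i t hi hag hx ⟨hV, hR, hK⟩
  obtain ⟨h1, h2, h3⟩ := hs i t hi hag hx hV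
  refine ⟨hVx _ _ h1, htrans _ _ _ (htrans _ _ _ hR h2) (hRx _ _), fun j hj => ?_⟩
  refine hKR _ _ _ (hRx _ _) ?_
  rcases Nat.lt_succ_iff_lt_or_eq.mp hj with h | rfl
  · exact hKR _ _ _ h2 (hK j h)
  · exact h3

/-- Programs with counting loops only terminate in polynomial time. -/
theorem exec_toProg (c : Cmd) (hwf : c.wf = true) (h0 : c.writesIReg 0 = false) (s : State)
    (hn : 1 ≤ s.ireg 0) :
    ∃ k, Exec c.toProg s (c.run s) k ∧ k ≤ c.weight * s.ireg 0 ^ c.depth := by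
  induction c generalizing s with
  | skip => exact ⟨_, .skip s, by simp [weight, depth]⟩
  | iset x e => exact ⟨_, .iset s x e, by simp [weight, depth]⟩
  | iput a i j e => exact ⟨_, .iput s a i j e, by simp [weight, depth]⟩
  | rset x e => exact ⟨_, .rset s x e, by simp [weight, depth]⟩
  | rput a i j e => exact ⟨_, .rput s a i j e, by simp [weight, depth]⟩
  | seq p q hp hq =>
    simp only [wf, Bool.and_eq_true] at hwf
    simp only [writesIReg, Bool.or_eq_false_iff] at h0
    have hl : p.weight * s.ireg 0 ^ p.depth ≤ p.weight * s.ireg 0 ^ max p.depth q.depth :=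
      Nat.mul_le_mul_left _ (Nat.pow_le_pow_right hn (le_max_left _ _))
    have hr : q.weight * s.ireg 0 ^ q.depth ≤ q.weight * s.ireg 0 ^ max p.depth q.depth :=
      Nat.mul_le_mul_left _ (Nat.pow_le_pow_right hn (le_max_right _ _))
    have hreg := (p.run_agree s).ireg 0 h0.1
    obtain ⟨k, hk, hk'⟩ := hp hwf.1 h0.1 s hn
    obtain ⟨l, hl, hl'⟩ := hq hwf.2 h0.2 (p.run s) (by rw [hreg]; exact hn)
    rw [hreg] at hl'
    refine ⟨k + l, .seq hk hl, ?_⟩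
    simp only [weight, depth, add_mul]
    omega
  | ite b p q hp hq =>
    simp only [wf, Bool.and_eq_true] at hwf
    simp only [writesIReg, Bool.or_eq_false_iff] at h0
    have hl : p.weight * s.ireg 0 ^ p.depth ≤ p.weight * s.ireg 0 ^ max p.depth q.depth :=
      Nat.mul_le_mul_left _ (Nat.pow_le_pow_right hn (le_max_left _ _))
    have hr : q.weight * s.ireg 0 ^ q.depth ≤ q.weight * s.ireg 0 ^ max p.depth q.depth :=
      Nat.mul_le_mul_left _ (Nat.pow_le_pow_right hn (le_max_right _ _))
    have h1 : b.cost + 1 ≤ (b.cost + 1) * s.ireg 0 ^ max p.depth q.depth :=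
      Nat.le_mul_of_pos_right _ (Nat.pow_pos hn)
    by_cases hb : b.holds s
    · obtain ⟨k, hk, hk'⟩ := hp hwf.1 h0.1 s hn
      refine ⟨b.cost + 1 + k, ?_, ?_⟩
      · simp only [run, hb, if_true]; exact .ite_true hb hk
      · rw [weight, depth, add_mul, add_mul p.weight]; omega
    · obtain ⟨k, hk, hk'⟩ := hq hwf.2 h0.2 s hn
      refine ⟨b.cost + 1 + k, ?_, ?_⟩
      · simp only [run, hb, if_false]; exact .ite_false hb hk
      · rw [weight, depth, add_mul, add_mul p.weight]; omega
  | loop x p hp =>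
    obtain ⟨hx, hp0, hpx, hpw⟩ := wf_loop hwf
    -- Each iteration costs 8 beyond the body: 4 for the test and 4 for the increment. The final
    -- failing test costs 4 and resetting the counter costs 2, whence the 14 = 8 + 4 + 2 in
    -- `weight`.
    have key : ∀ (m : ℕ) (t : State), 1 ≤ t.ireg 0 → t.ireg x + m = t.ireg 0 →
        ∃ k, Exec (.while (.ilt (.reg x) (.reg 0))
            (.seq p.toProg (.iset x (.add (.reg x) (.const 1))))) t
          ((fun t => (p.run t).iset x (t.ireg x + 1))^[m] t) k ∧
          k ≤ m * (p.weight * t.ireg 0 ^ p.depth + 8) + 4 := by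
      intro m
      induction m with
      | zero =>
        intro t _ ht
        exact ⟨_, .while_false (by simp [BExp.holds, IExp.eval]; omega),
          by simp [BExp.cost, IExp.cost]⟩
      | succ m ih =>
        intro t htn ht
        obtain ⟨k, hk, hk'⟩ := hp hpw hp0 t htn
        have e0 : ((p.run t).iset x (t.ireg x + 1)).ireg 0 = t.ireg 0 := by
          simp [State.iset, hx.symm, (p.run_agree t).ireg 0 hp0]
        have ex : ((p.run t).iset x (t.ireg x + 1)).ireg x = t.ireg x + 1 := by simp [State.iset]
        obtain ⟨l, hl, hl'⟩ := ih ((p.run t).iset x (t.ireg x + 1)) (by rw [e0]; exact htn)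
          (by rw [e0, ex]; omega)
        rw [Function.iterate_succ_apply]
        have hi : Exec (.iset x (.add (.reg x) (.const 1))) (p.run t)
            ((p.run t).iset x (t.ireg x + 1)) 4 := by
          have := Exec.iset (p.run t) x (.add (.reg x) (.const 1))
          simpa [IExp.eval, IExp.cost, (p.run_agree t).ireg x hpx] using this
        refine ⟨_, .while_true (by simp [BExp.holds, IExp.eval]; omega) (.seq hk hi) hl, ?_⟩
        rw [e0] at hl'
        simp only [BExp.cost, IExp.cost, add_mul, one_mul]
        omega
    have e0 : (s.iset x 0).ireg 0 = s.ireg 0 := by simp [State.iset, hx.symm]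
    have ex : (s.iset x 0).ireg x = 0 := by simp [State.iset]
    obtain ⟨k, hk, hk'⟩ := key (s.ireg 0) (s.iset x 0) (by rw [e0]; exact hn) (by rw [e0, ex]; omega)
    refine ⟨_, .seq (.iset s x (.const 0)) hk, ?_⟩
    rw [e0] at hk'
    have h1 : 1 ≤ s.ireg 0 ^ p.depth := Nat.pow_pos hn
    have h2 : s.ireg 0 ≤ s.ireg 0 * s.ireg 0 ^ p.depth := Nat.le_mul_of_pos_right _ h1
    simp only [weight, depth, IExp.cost, pow_succ]
    have h3 : s.ireg 0 * (p.weight * s.ireg 0 ^ p.depth + 8) =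
      p.weight * (s.ireg 0 ^ p.depth * s.ireg 0) + 8 * s.ireg 0 := by ring
    have h4 : (p.weight + 14) * (s.ireg 0 ^ p.depth * s.ireg 0) =
      p.weight * (s.ireg 0 ^ p.depth * s.ireg 0) + 14 * (s.ireg 0 * s.ireg 0 ^ p.depth) := by ring
    omega

end Cmd

end RealRAM

/-! ### Steepest walks and the extension of partial greyscales -/

/-- A walk of length `ℓ` from `x` to `y` along `A` whose interior vertices lie in `U`. -/
inductive InnerWalk {V : Type*} (A : V → V → Prop) (U : V → Prop) : V → V → ℕ → Prop
  | edge {x y : V} (h : A x y) : InnerWalk A U x y 1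
  | cons {x m y : V} {l : ℕ} (h : A x m) (hm : U m) (hw : InnerWalk A U m y l) :
      InnerWalk A U x y (l + 1)

namespace InnerWalk

variable {V : Type*} {A : V → V → Prop} {U U' : V → Prop} {x y m k : V} {l p q : ℕ}

theorem pos (h : InnerWalk A U x y l) : 0 < l := by cases h <;> omega

theorem mono (hU : ∀ v, U v → U' v) (h : InnerWalk A U x y l) : InnerWalk A U' x y l := by
  induction h with
  | edge h => exact .edge h
  | cons h hm _ ih => exact .cons h (hU _ hm) ih

theorem trans (h : InnerWalk A U x m p) (hm : U m) (h' : InnerWalk A U m y q) :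
    InnerWalk A U x y (p + q) := by
  induction h with
  | edge h => rw [add_comm]; exact .cons h hm h'
  | cons h hm' _ ih => rw [add_right_comm]; exact .cons h hm' (ih hm h')

/-- A walk with interior in `U` either avoids `k` or can be shortcut so that it passes through `k`
exactly once. -/
theorem split (hU : ∀ v, U' v → v ≠ k → U v) (h : InnerWalk A U' x y l) :
    InnerWalk A U x y l ∨
      U' k ∧ ∃ p q, p + q ≤ l ∧ InnerWalk A U x k p ∧ InnerWalk A U k y q := by
  induction h with
  | edge h => exact .inl (.edge h)
  | @cons x m y l h hm hw ih =>
    by_cases hmk : m = k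
    · subst hmk
      refine .inr ⟨hm, ?_⟩
      -- The walk enters `k` at once. If its tail returns to `k`, everything before the last return
      -- is dropped; hence `p + q ≤ l` and not equality.
      rcases ih with ih | ⟨_, p, q, hpq, _, hq⟩
      · exact ⟨1, l, by omega, .edge h, ih⟩
      · exact ⟨1, q, by omega, .edge h, hq⟩
    · have hm' := hU m hm hmk
      rcases ih with ih | ⟨hk, p, q, hpq, hp, hq⟩
      · exact .inl (.cons h hm' ih)
      · exact .inr ⟨hk, p + 1, q, by omega, .cons h hm' hp, hq⟩

/-- Tones bounded by `a` on the edges leaving `U` and the start bound the difference of the ends. -/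
theorem sub_le {f : V → ℝ} {a : ℝ} (h : InnerWalk A U x y l) (hx : U x)
    (hf : ∀ v w, U v → A v w → f w - f v ≤ a) : f y - f x ≤ a * l := by
  induction h with
  | edge h => simpa using hf _ _ hx h
  | cons h hm _ ih =>
    have h1 := hf _ _ hx h
    have h2 := ih hm
    push_cast
    linarith

end InnerWalk

/-- For the partial greyscale `F` on `T`, no walk through uncoloured vertices (other than a single
edge) between coloured ones is steeper than `a`. -/
def SlopeBound {V : Type*} (A : V → V → Prop) (T : V → Prop) (F : V → ℝ) (a : ℝ) : Prop :=
  ∀ x y l, T x → T y → 2 ≤ l → InnerWalk A (fun v => ¬ T v) x y l → F y - F x ≤ a * l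

/-- A witness that all extensions of the partial greyscale `F` on `T` beat `f`. -/
def Worse {V : Type*} (A : V → V → Prop) (T : V → Prop) (F f : V → ℝ) : Prop :=
  ∃ (a : ℝ) (T₁ : V → Prop), (∀ x, T₁ x → T x) ∧ SlopeBound A T F a ∧
    (∀ x y, T x → T y → A x y → ¬ (T₁ x ∧ T₁ y) → F y - F x ≤ a) ∧
    (∀ x, T₁ x → f x = F x) ∧ ∃ x y, A x y ∧ ¬ (T₁ x ∧ T₁ y) ∧ a < f y - f x

/-- `u`, `w` and a walk from `w` to `v` form a steepest walk through uncoloured vertices. -/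
structure IsSteepest {V : Type*} (A : V → V → Prop) (T : V → Prop) (F : V → ℝ) (w : V) (u v : V)
    (l : ℕ) (a : ℝ) : Prop where
  hu : T u
  hw : ¬ T w
  hv : T v
  adj : A u w
  walk : InnerWalk A (fun v => ¬ T v) w v l
  bound : SlopeBound A T F a
  slope : F v - F u = a * (l + 1)

namespace IsSteepest

variable {V : Type*} {A : V → V → Prop} {T : V → Prop} {F F' f : V → ℝ} {u v w : V}
  {l : ℕ} {a : ℝ}

/-- The walk `u`, `w`, `u` has slope zero. -/
theorem nonneg (h : IsSteepest A T F w u v l a) (hA : ∀ x y, A x y → A y x) : 0 ≤ a := by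
  have := h.bound u u 2 h.hu h.hu le_rfl (.cons h.adj h.hw (.edge (hA _ _ h.adj)))
  norm_num at this
  linarith

/-- Walks touching `w` are completed to walks between old coloured vertices: one starting at `w` is
preceded by the edge from `u`, one ending at `w` is followed by the walk to `v`. Both added pieces
have slope exactly `a`, so the old bound gives the new one. The condition `hxy` excludes only single
edges between old coloured vertices, whose tones are already fixed and may exceed `a`. -/
theorem sub_le (h : IsSteepest A T F w u v l a) (hA : ∀ x y, A x y → A y x)
    (hF : ∀ x, T x → F' x = F x) (hFw : F' w = F u + a) {x y : V} {p : ℕ}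
    (hx : T x ∨ x = w) (hy : T y ∨ y = w) (hxy : x = w ∨ y = w ∨ 2 ≤ p)
    (hp : InnerWalk A (fun v => ¬ (T v ∨ v = w)) x y p) : F' y - F' x ≤ a * p := by
  have hp' : InnerWalk A (fun v => ¬ T v) x y p := hp.mono fun v hv => fun h => hv (.inl h)
  have hp0 := hp.pos
  have ha := h.nonneg hA
  have hs := h.slope
  have hl := h.walk.pos
  by_cases hxw : x = w
  · subst hxw
    by_cases hyw : y = x
    · subst hyw
      simp only [sub_self]; positivity
    · have hy' : T y := hy.resolve_right hyw
      have := h.bound u y (p + 1) h.hu hy' (by omega) (.cons h.adj h.hw hp')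
      rw [hF y hy', hFw]
      push_cast at this
      linarith
  · have hx' : T x := hx.resolve_right hxw
    by_cases hyw : y = w
    · subst hyw
      have := h.bound x v (p + l) hx' h.hv (by omega) (hp'.trans h.hw h.walk)
      rw [hF x hx', hFw]
      push_cast at this
      linarith
    · have hy' : T y := hy.resolve_right hyw
      rw [hF x hx', hF y hy']
      exact h.bound x y p hx' hy' (by tauto) hp'

theorem slopeBound (h : IsSteepest A T F w u v l a) (hA : ∀ x y, A x y → A y x)
    (hF : ∀ x, T x → F' x = F x) (hFw : F' w = F u + a) :
    SlopeBound A (fun x => T x ∨ x = w) F' a :=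
  fun _ _ _ hx hy h2 hp => h.sub_le hA hF hFw hx hy (.inr (.inr h2)) hp

theorem le_of_slopeBound (h : IsSteepest A T F w u v l a) {b : ℝ} (hb : SlopeBound A T F b) :
    a ≤ b := by
  have hl := h.walk.pos
  have := hb u v (l + 1) h.hu h.hv (by omega) (.cons h.adj h.hw h.walk)
  push_cast at this
  rw [h.slope] at this
  exact le_of_mul_le_mul_right this (by positivity)

/-- The same threshold `b` and the same set `T₁` still work, because the new slope `a` is at most
`b`. -/
theorem worse_mono (h : IsSteepest A T F w u v l a) (hA : ∀ x y, A x y → A y x)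
    (hF : ∀ x, T x → F' x = F x) (hFw : F' w = F u + a) (hf : Worse A T F f) :
    Worse A (fun x => T x ∨ x = w) F' f := by
  obtain ⟨b, T₁, hT, hb, he, hfF, hne⟩ := hf
  have hab := h.le_of_slopeBound hb
  refine ⟨b, T₁, fun x hx => .inl (hT x hx), ?_, ?_, ?_, hne⟩
  · intro x y p hx hy h2 hp
    exact (h.slopeBound hA hF hFw x y p hx hy h2 hp).trans (by gcongr)
  · intro x y hx hy hxy hne
    by_cases hw : x = w ∨ y = w
    · have := h.sub_le hA hF hFw hx hy (p := 1) (by tauto) (.edge hxy)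
      norm_num at this
      linarith
    · have hx' : T x := by tauto
      have hy' : T y := by tauto
      rw [hF x hx', hF y hy']
      exact he x y hx' hy' hxy hne
  · exact fun x hx => (hfF x hx).trans (hF x (hT x hx)).symm

/-- The witness is the threshold `a` with `T₁ = T`. If no edge leaving `T` or outside it rose by
more than `a` under `f`, then the rise `a * (l + 1)` along the steepest walk would force equality on
its first edge, that is `f w = F u + a`. -/
theorem worse_of_ne (h : IsSteepest A T F w u v l a) (hA : ∀ x y, A x y → A y x)
    (hF : ∀ x, T x → F' x = F x) (hFw : F' w = F u + a) (hf : ∀ x, T x → f x = F x)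
    (hfw : f w ≠ F' w) : Worse A (fun x => T x ∨ x = w) F' f := by
  refine ⟨a, T, fun x hx => .inl hx, h.slopeBound hA hF hFw, ?_,
    fun x hx => (hf x hx).trans (hF x hx).symm, ?_⟩
  · intro x y hx hy hxy hne
    have := h.sub_le hA hF hFw hx hy (p := 1) (by tauto) (.edge hxy)
    norm_num at this
    linarith
  · by_contra! hcon
    apply hfw
    have h1 := hcon u w h.adj fun _ => h.hw
    have h2 := h.walk.sub_le h.hw fun x y hx hxy => hcon x y hxy fun hh => absurd hh hx
    have h3 := h.slope
    rw [← hf u h.hu, ← hf v h.hv] at h3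
    rw [hFw, ← hf u h.hu]
    linarith

end IsSteepest

/-! ### Comparison of gradation vectors by counting -/

/-- The number of pairs in `S` whose squared tone is `c`. -/
noncomputable def toneCount {V : Type*} (S : Finset (V × V)) (F : V → ℝ) (c : ℝ) : ℕ :=
  (S.filter fun p => (F p.1 - F p.2) ^ 2 = c).card

/-- Lexicographic comparison of squared tones, from the largest one down. -/
def ToneLt {V : Type*} (S : Finset (V × V)) (F f : V → ℝ) : Prop :=
  ∃ c, toneCount S F c < toneCount S f c ∧ ∀ d, c < d → toneCount S F d = toneCount S f d

/-- Pairs inside `T₁` contribute equally to both colourings. On the remaining pairs `B`, `F` stays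
at or below `a` while `f` exceeds it, so the largest squared tone of `f` on `B` is the first place
where the multiplicities differ. -/
theorem toneLt_of_worse {V : Type*} {A : V → V → Prop} (hA : ∀ x y, A x y → A y x)
    {S : Finset (V × V)} (hS : ∀ x y, (x, y) ∈ S ↔ A x y) {T : V → Prop} (hT : ∀ x, T x)
    {F f : V → ℝ} (h : Worse A T F f) : ToneLt S F f := by
  classical
  obtain ⟨a, T₁, -, -, he, hfF, x₀, y₀, hxy₀, hne₀, hlt⟩ := h
  set B := S.filter fun p => ¬ (T₁ p.1 ∧ T₁ p.2) with hB
  have hmem : (x₀, y₀) ∈ B := by simp [hB, hS, hxy₀]; tauto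
  have hbad : ∀ p ∈ B, (F p.1 - F p.2) ^ 2 ≤ a ^ 2 := by
    intro p hp
    simp only [hB, Finset.mem_filter] at hp
    have h1 := he p.1 p.2 (hT _) (hT _) ((hS _ _).1 hp.1) hp.2
    have h2 := he p.2 p.1 (hT _) (hT _) (hA _ _ ((hS _ _).1 hp.1)) (by tauto)
    exact sq_le_sq' (by linarith) (by linarith)
  have ha : 0 ≤ a := by
    have h1 := he x₀ y₀ (hT _) (hT _) hxy₀ hne₀
    have h2 := he y₀ x₀ (hT _) (hT _) (hA _ _ hxy₀) (by tauto)
    linarith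
  obtain ⟨q, hqB, hq⟩ := B.exists_max_image (fun p => (f p.1 - f p.2) ^ 2) ⟨_, hmem⟩
  have hqa : a ^ 2 < (f q.1 - f q.2) ^ 2 := by
    have := hq _ hmem
    nlinarith
  -- From this level upwards `F` has no pair in `B`, so the excess of `f` is exactly its own count
  -- on `B`.
  have hcount : ∀ d, (f q.1 - f q.2) ^ 2 ≤ d →
      toneCount S f d = toneCount S F d + (B.filter fun p => (f p.1 - f p.2) ^ 2 = d).card := by
    intro d hd
    have e1 : (S.filter fun p => (F p.1 - F p.2) ^ 2 = d) =
        (S.filter fun p => (f p.1 - f p.2) ^ 2 = d).filter fun p => T₁ p.1 ∧ T₁ p.2 := by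
      ext p
      simp only [Finset.mem_filter]
      constructor
      · rintro ⟨hp, hd'⟩
        have : T₁ p.1 ∧ T₁ p.2 := by
          by_contra hcon
          have := hbad p (by simp only [hB, Finset.mem_filter]; exact ⟨hp, hcon⟩)
          linarith
        rw [hfF _ this.1, hfF _ this.2]
        exact ⟨⟨hp, hd'⟩, this⟩
      · rintro ⟨⟨hp, hd'⟩, h1, h2⟩
        rw [hfF _ h1, hfF _ h2] at hd'
        exact ⟨hp, hd'⟩
    have e2 : (B.filter fun p => (f p.1 - f p.2) ^ 2 = d) =
        (S.filter fun p => (f p.1 - f p.2) ^ 2 = d).filter fun p => ¬ (T₁ p.1 ∧ T₁ p.2) := by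
      rw [hB, Finset.filter_comm]
    rw [toneCount, toneCount, e1, e2, Finset.card_filter_add_card_filter_not]
  refine ⟨(f q.1 - f q.2) ^ 2, ?_, fun d hd => ?_⟩
  · rw [hcount _ le_rfl]
    have : 0 < (B.filter fun p => (f p.1 - f p.2) ^ 2 = (f q.1 - f q.2) ^ 2).card :=
      Finset.card_pos.2 ⟨q, by simp [hqB]⟩
    omega
  · rw [hcount _ hd.le, Finset.card_eq_zero.2, add_zero]
    refine Finset.filter_eq_empty_iff.2 fun p hp hpd => ?_
    have := hq p hp
    linarith

/-- Decreasing lists compare lexicographically as their multiplicities do. -/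
theorem List.lt_of_count_lt {l₁ l₂ : List ℝ} (h₁ : l₁.Pairwise (· ≥ ·)) (h₂ : l₂.Pairwise (· ≥ ·))
    {c : ℝ} (hc : l₁.count c < l₂.count c) (hd : ∀ d, c < d → l₁.count d = l₂.count d) :
    l₁ < l₂ := by
  induction l₁ generalizing l₂ with
  | nil =>
    cases l₂ with
    | nil => simp at hc
    | cons b l₂ => exact List.nil_lt_cons _ _
  | cons a l₁ ih =>
    cases l₂ with
    | nil => simp at hc
    | cons b l₂ =>
      rw [List.pairwise_cons] at h₁ h₂
      rcases lt_trichotomy a b with hab | rfl | hab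
      · exact List.cons_lt_cons_iff.2 (.inl hab)
      · refine List.cons_lt_cons_iff.2 (.inr ⟨rfl, ih h₁.2 h₂.2 ?_ fun d hcd => ?_⟩)
        · simp only [List.count_cons] at hc; omega
        · have := hd d hcd
          simp only [List.count_cons] at this; omega
      -- Here the head `a` of the first list exceeds every entry of the second. If `c < a`, the
      -- multiplicities of `a` would have to agree; if `c ≥ a`, the second list does not contain
      -- `c`.
      · exfalso
        have hz : ∀ d, b < d → (b :: l₂).count d = 0 := by
          intro d hbd
          refine List.count_eq_zero.2 fun hmem => ?_
          rcases List.mem_cons.1 hmem with rfl | hmem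
          · exact lt_irrefl _ hbd
          · exact absurd (h₂.1 d hmem) (not_le.2 hbd)
        rcases lt_or_ge c a with hca | hca
        · have := hd a hca
          rw [hz a hab] at this
          simp at this
        · rw [hz c (hab.trans_le hca)] at hc
          omega

theorem SimpleGraph.exists_adj_of_connected {V : Type*} {G : SimpleGraph V} (hconn : G.Connected) {T : V → Prop}
    {x y : V} (hx : T x) (hy : ¬ T y) : ∃ x y, T x ∧ ¬ T y ∧ G.Adj x y := by
  obtain ⟨w⟩ := hconn.preconnected x y
  obtain ⟨d, -, h1, h2⟩ := w.exists_boundary_dart {v | T v} hx hy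
  exact ⟨_, _, h1, h2, d.adj⟩

section Gradation

variable {n : ℕ} (G : SimpleGraph (Fin n)) [DecidableRel G.Adj]

/-- The ordered pairs of adjacent vertices. -/
def adjPairs : Finset (Fin n × Fin n) := Finset.univ.filter fun p => G.Adj p.1 p.2

theorem mem_adjPairs (x y : Fin n) : (x, y) ∈ adjPairs G ↔ G.Adj x y := by simp [adjPairs]

/-- Every edge gives two ordered pairs. The factor two is the handshake identity for the subgraph
`H` of the edges with tone `c`. -/
theorem toneCount_adjPairs (f : Fin n → ℝ) {c : ℝ} (hc : 0 ≤ c) :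
    toneCount (adjPairs G) f (c ^ 2) = 2 * (gradation G f).count c := by
  classical
  have h1 : (gradation G f).count c = (G.edgeFinset.filter fun e => edgeTone f e = c).card := by
    rw [← Multiset.coe_count, gradation, Multiset.sort_eq, Multiset.count_map, Finset.card,
      Finset.filter_val]
    simp only [eq_comm]
  have hmem : ∀ p : Fin n × Fin n, (f p.1 - f p.2) ^ 2 = c ^ 2 ↔ edgeTone f s(p.1, p.2) = c := by
    intro p
    have : edgeTone f s(p.1, p.2) = |f p.1 - f p.2| := rfl
    rw [this, ← sq_eq_sq₀ (abs_nonneg _) hc, sq_abs]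
  let H : SimpleGraph (Fin n) :=
    { Adj := fun x y => G.Adj x y ∧ edgeTone f s(x, y) = c
      symm := ⟨fun x y h => ⟨h.1.symm, by rw [Sym2.eq_swap]; exact h.2⟩⟩
      loopless := ⟨fun x h => G.loopless.irrefl x h.1⟩ }
  have h2 : (G.edgeFinset.filter fun e => edgeTone f e = c) = H.edgeFinset := by
    ext e
    induction e with
    | h x y => simp [H]
  have h3 : (adjPairs G).filter (fun p => (f p.1 - f p.2) ^ 2 = c ^ 2) =
      Finset.univ.filter fun (x, y) => H.Adj x y := by
    ext p
    simp [adjPairs, H, hmem]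
  rw [h1, h2, toneCount, h3, H.two_mul_card_edgeFinset]

theorem gradation_lt_of_toneLt {f f' : Fin n → ℝ} (h : ToneLt (adjPairs G) f f') :
    gradation G f < gradation G f' := by
  obtain ⟨c, hc, hd⟩ := h
  have hc0 : 0 ≤ c := by
    have : 0 < toneCount (adjPairs G) f' c := by omega
    obtain ⟨p, hp⟩ := Finset.card_pos.1 this
    rw [← (Finset.mem_filter.1 hp).2]
    positivity
  -- The level `c` is a squared tone, so the lists first differ at its root.
  have hs := Real.sq_sqrt hc0
  refine List.lt_of_count_lt (Multiset.pairwise_sort _ _) (Multiset.pairwise_sort _ _)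
    (c := √c) ?_ fun d hcd => ?_
  · have h1 := toneCount_adjPairs G f (Real.sqrt_nonneg c)
    have h2 := toneCount_adjPairs G f' (Real.sqrt_nonneg c)
    rw [hs] at h1 h2
    simp only [gradation] at h1 h2 ⊢
    omega
  · have hd0 : 0 ≤ d := (Real.sqrt_nonneg c).trans hcd.le
    have h1 := toneCount_adjPairs G f hd0
    have h2 := toneCount_adjPairs G f' hd0
    have h3 := hd (d ^ 2) ((Real.sqrt_lt' (by linarith [Real.sqrt_nonneg c])).1 hcd)
    simp only [gradation] at h1 h2 ⊢
    omega

/-- Squared tones determine the multiplicities of nonnegative values only; negative values do not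
occur. Sorted lists with equal multiplicities coincide. -/
theorem gradation_eq_of_toneCount_eq {f f' : Fin n → ℝ}
    (h : ∀ c, toneCount (adjPairs G) f c = toneCount (adjPairs G) f' c) :
    gradation G f = gradation G f' := by
  have hneg : ∀ (f : Fin n → ℝ) (c : ℝ), c < 0 → (gradation G f).count c = 0 := by
    intro f c hc
    refine List.count_eq_zero.2 fun hmem => ?_
    rw [gradation, Multiset.mem_sort, Multiset.mem_map] at hmem
    obtain ⟨e, -, rfl⟩ := hmem
    induction e with
    | h x y => exact absurd hc (not_lt.2 (abs_nonneg (f x - f y)))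
  refine (List.perm_iff_count.2 fun c => ?_).eq_of_pairwise' (Multiset.pairwise_sort _ _)
    (Multiset.pairwise_sort _ _)
  rcases lt_or_ge c 0 with hc | hc
  · exact (hneg f c hc).trans (hneg f' c hc).symm
  · have h1 := toneCount_adjPairs G f hc
    have h2 := toneCount_adjPairs G f' hc
    rw [h] at h1
    simp only [gradation] at h1 h2 ⊢
    omega

end Gradation

/-! ### The algorithm: shortest walks through uncoloured vertices -/

namespace RealRAM

namespace Cmd

/-- Relaxation of the distance from register `5` to register `6` through register `4`. -/
def relax : Cmd :=
  .ite (.and (.and (.ilt (.const 0) (.get 3 (.reg 5) (.reg 4)))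
      (.ilt (.const 0) (.get 3 (.reg 4) (.reg 6))))
      (.not (.and (.ilt (.const 0) (.get 3 (.reg 5) (.reg 6)))
        (.not (.ilt (.add (.get 3 (.reg 5) (.reg 4)) (.get 3 (.reg 4) (.reg 6)))
          (.get 3 (.reg 5) (.reg 6)))))))
    (.iput 3 (.reg 5) (.reg 6) (.add (.get 3 (.reg 5) (.reg 4)) (.get 3 (.reg 4) (.reg 6))))
    .skip

/-- Array `3` receives the adjacency matrix. -/
def initDist : Cmd :=
  .loop 4 (.loop 5 (.iput 3 (.reg 4) (.reg 5) (.get 0 (.reg 4) (.reg 5))))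

/-- The Floyd-Warshall loops, with the uncoloured vertices as intermediate vertices. -/
def floydWarshall : Cmd :=
  .loop 4 (.ite (.ilt (.const 0) (.get 2 (.reg 4) (.const 0))) .skip (.loop 5 (.loop 6 relax)))

theorem initDist_run (s : State) {i j : ℕ} (hi : i < s.ireg 0) (hj : j < s.ireg 0) :
    (initDist.run s).iarr 3 i j = s.iarr 0 i j := by
  refine run_loop_induct (x := 4) (s := s)
    (fun m t => ∀ i < m, ∀ j < s.ireg 0, t.iarr 3 i j = s.iarr 0 i j)
    (fun i hi => absurd hi (by omega)) ?_ i hi j hj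
  intro m t hm hag hx ih i hi j hj
  have e0 : t.ireg 0 = s.ireg 0 := hag.ireg 0 rfl
  -- The inner invariant includes the finished rows as well as the filled part of row `m`, since the
  -- writes must not spoil the former.
  have key := run_loop_induct (x := 5) (s := t)
    (c := .iput 3 (.reg 4) (.reg 5) (.get 0 (.reg 4) (.reg 5)))
    (fun p u => ∀ i j, i < m ∧ j < s.ireg 0 ∨ i = m ∧ j < p → u.iarr 3 i j = s.iarr 0 i j)
    (by
      rintro i j (⟨h1, h2⟩ | ⟨h1, h2⟩)
      · exact ih i h1 j h2
      · omega)
    (by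
      intro p u hp hag' hxp ihp i j hij
      have e4 : u.ireg 4 = m := (hag'.ireg 4 rfl).trans hx
      have ea : u.iarr 0 = s.iarr 0 := (hag'.iarr 0 rfl).trans (hag.iarr 0 rfl)
      simp only [run, State.iput, State.iset, IExp.eval, e4, hxp, ea, true_and]
      by_cases h : i = m ∧ j = p
      · rw [if_pos h, h.1, h.2]
      · rw [if_neg h]
        exact ihp i j (by omega))
  exact key i j (by rw [e0]; omega)

/-- The entry 0 encodes the absence of a known walk, which is why the test demands two positive
summands and accepts a zero entry as improvable. -/
theorem relax_run (t : State) (i j : ℕ) :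
    (relax.run t).iarr 3 i j = if (i = t.ireg 5 ∧ j = t.ireg 6) ∧
      0 < t.iarr 3 i (t.ireg 4) ∧ 0 < t.iarr 3 (t.ireg 4) j ∧
      (t.iarr 3 i j = 0 ∨ t.iarr 3 i (t.ireg 4) + t.iarr 3 (t.ireg 4) j < t.iarr 3 i j)
      then t.iarr 3 i (t.ireg 4) + t.iarr 3 (t.ireg 4) j else t.iarr 3 i j := by
  unfold relax
  split_ifs with h
  · obtain ⟨⟨rfl, rfl⟩, h1, h2, h3⟩ := h
    rw [run_ite_pos]
    · simp [run, State.iput, IExp.eval]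
    · simp only [BExp.holds, IExp.eval]
      exact ⟨⟨h1, h2⟩, by omega⟩
  · by_cases hij : i = t.ireg 5 ∧ j = t.ireg 6
    · obtain ⟨rfl, rfl⟩ := hij
      rw [run_ite_neg]
      · rfl
      · simp only [BExp.holds, IExp.eval]
        exact fun h1 => h ⟨⟨rfl, rfl⟩, h1.1.1, h1.1.2, by omega⟩
    · by_cases hb : BExp.holds t (.and (.and (.ilt (.const 0) (.get 3 (.reg 5) (.reg 4)))
        (.ilt (.const 0) (.get 3 (.reg 4) (.reg 6))))
        (.not (.and (.ilt (.const 0) (.get 3 (.reg 5) (.reg 6)))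
        (.not (.ilt (.add (.get 3 (.reg 5) (.reg 4)) (.get 3 (.reg 4) (.reg 6)))
          (.get 3 (.reg 5) (.reg 6)))))))
      · rw [run_ite_pos _ _ hb]
        simp [run, State.iput, IExp.eval, hij]
      · rw [run_ite_neg _ _ hb]
        rfl

/-- Existing distances persist and can only decrease. -/
def DistLe (t t' : State) : Prop :=
  ∀ i j, 0 < t.iarr 3 i j → 0 < t'.iarr 3 i j ∧ t'.iarr 3 i j ≤ t.iarr 3 i j

theorem DistLe.trans {t u v : State} (h : DistLe t u) (h' : DistLe u v) : DistLe t v :=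
  fun i j hij => ⟨(h' i j (h i j hij).1).1, (h' i j (h i j hij).1).2.trans (h i j hij).2⟩

theorem relax_distLe (t : State) : DistLe t (relax.run t) := by
  intro i j hij
  rw [relax_run]
  split_ifs with h <;> omega

/-- Array `3` contains the lengths of the shortest walks with interior in `U`. -/
def IsDist {n : ℕ} (A : Fin n → Fin n → Prop) (U : Fin n → Prop) (t : State) : Prop :=
  (∀ i j : Fin n, 0 < t.iarr 3 i j → InnerWalk A U i j (t.iarr 3 i j)) ∧
  ∀ (i j : Fin n) l, InnerWalk A U i j l → 0 < t.iarr 3 i j ∧ t.iarr 3 i j ≤ l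

/-- Two invariants suffice: every positive entry is the length of an actual walk, and after stage
`k` it is at most the length of any walk whose interior vertices are uncoloured with index below
`k`. Only upper bounds are required of the entries, so updating the array in place does no harm. -/
theorem floydWarshall_run {n : ℕ} (A : Fin n → Fin n → Prop) (s : State) (hn : s.ireg 0 = n)
    (h0 : ∀ i j : Fin n, (A i j → s.iarr 3 i j = 1) ∧ (¬ A i j → s.iarr 3 i j = 0)) :
    IsDist A (fun v => s.iarr 2 v 0 = 0) (floydWarshall.run s) := by
  set U : Fin n → Prop := fun v => s.iarr 2 v 0 = 0 with hU
  let Sound : State → Prop := fun t =>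
    ∀ i j : Fin n, 0 < t.iarr 3 i j → InnerWalk A U i j (t.iarr 3 i j)
  let Complete : ℕ → State → Prop := fun k t =>
    ∀ (i j : Fin n) l, InnerWalk A (fun v => U v ∧ v.val < k) i j l →
      0 < t.iarr 3 i j ∧ t.iarr 3 i j ≤ l
  have key := run_loop_induct (x := 4) (s := s)
    (c := .ite (.ilt (.const 0) (.get 2 (.reg 4) (.const 0))) .skip (.loop 5 (.loop 6 relax)))
    (fun k t => Sound t ∧ Complete k t) ?_ ?_
  · refine ⟨key.1, fun i j l h => key.2 i j l (h.mono fun v hv => ⟨hv, ?_⟩)⟩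
    rw [hn]; exact v.2
  · constructor
    · intro i j hij
      by_cases h : A i j
      · change 0 < s.iarr 3 i j at hij
        change InnerWalk A U i j (s.iarr 3 i j)
        rw [(h0 i j).1 h]; exact .edge h
      · exact absurd ((h0 i j).2 h) (ne_of_gt hij)
    · intro i j l h
      change 0 < s.iarr 3 i j ∧ s.iarr 3 i j ≤ l
      cases h with
      | edge h => simp [(h0 i j).1 h]
      | cons _ hm _ => exact absurd hm.2 (by omega)
  · rintro k t hk hag hx ⟨hS, hC⟩
    have e2 : t.iarr 2 = s.iarr 2 := hag.iarr 2 rfl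
    have e0 : t.ireg 0 = n := (hag.ireg 0 rfl).trans hn
    rw [hn] at hk
    simp only [run, BExp.holds, IExp.eval, hx]
    by_cases hc : 0 < t.iarr 2 k 0
    · rw [if_pos hc]
      refine ⟨hS, fun i j l h => hC i j l (h.mono fun v hv => ⟨hv.1, ?_⟩)⟩
      have : v.val ≠ k := by
        rintro rfl
        have := hv.1
        rw [e2] at hc
        simp only [hU] at this
        omega
      omega
    · rw [if_neg hc]
      have hkU : U ⟨k, hk⟩ := by
        simp only [hU]; rw [e2] at hc; omega
      set kk : Fin n := ⟨k, hk⟩ with hkk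
      have loops := run_loop_cover (x := 5) (c := .loop 6 relax) (s := t)
        (fun t => t.ireg 4 = k ∧ t.ireg 0 = n ∧ Sound t ∧ Complete k t) DistLe
        (fun a t => ∀ b < n, ∀ i j : Fin n, i.val = a → j.val = b → ∀ p q,
          InnerWalk A (fun v => U v ∧ v.val < k) i kk p →
          InnerWalk A (fun v => U v ∧ v.val < k) kk j q →
          0 < t.iarr 3 i j ∧ t.iarr 3 i j ≤ p + q)
        (fun _ _ _ => DistLe.trans) (fun _ _ h => h) (fun _ _ _ _ h => ⟨h, le_rfl⟩)
        (by
          intro a t t' hR hK b hb i j hi hj p q hp hq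
          have h1 := hK b hb i j hi hj p q hp hq
          have h2 := hR i j h1.1
          omega)
        ⟨hx, e0, hS, hC⟩
        (by
          intro a u ha hag' hxa hV
          have inner := run_loop_cover (x := 6) (c := relax) (s := u)
            (fun t => t.ireg 4 = k ∧ t.ireg 5 = a ∧ t.ireg 0 = n ∧ Sound t ∧ Complete k t) DistLe
            (fun b t => ∀ i j : Fin n, i.val = a → j.val = b → ∀ p q,
              InnerWalk A (fun v => U v ∧ v.val < k) i kk p →
              InnerWalk A (fun v => U v ∧ v.val < k) kk j q →
              0 < t.iarr 3 i j ∧ t.iarr 3 i j ≤ p + q)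
            (fun _ _ _ => DistLe.trans) (fun _ _ h => h) (fun _ _ _ _ h => ⟨h, le_rfl⟩)
            (by
              intro b t t' hR hK i j hi hj p q hp hq
              have h1 := hK i j hi hj p q hp hq
              have h2 := hR i j h1.1
              omega)
            ⟨hV.1, hxa, hV.2⟩
            (by
              rintro b w hb hag'' hxb ⟨h4, h5, h00, hSw, hCw⟩
              have hD := relax_distLe w
              refine ⟨⟨((relax.run_agree w).ireg 4 rfl).trans h4,
                ((relax.run_agree w).ireg 5 rfl).trans h5,
                ((relax.run_agree w).ireg 0 rfl).trans h00, ?_, ?_⟩, hD, ?_⟩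
              · intro i j hij
                rw [relax_run] at hij ⊢
                rw [h4] at hij ⊢
                split_ifs with h
                · exact (hSw i kk h.2.1).trans hkU (hSw kk j h.2.2.1)
                · rw [if_neg h] at hij
                  exact hSw i j hij
              · intro i j l hl
                have h1 := hCw i j l hl
                have h2 := hD i j h1.1
                omega
              · intro i j hi hj p q hp hq
                have h1 := hCw i kk p hp
                have h2 := hCw kk j q hq
                simp only [hkk] at h1 h2
                rw [relax_run, h4, h5, hxb]
                split_ifs with h
                · omega
                · simp only [hi, hj, true_and, not_and, not_or] at h h1 h2 ⊢
                  have := h h1.1 h2.1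
                  omega)
          have e0' : u.ireg 0 = n := (hag'.ireg 0 rfl).trans e0
          rw [e0'] at inner
          exact ⟨⟨inner.1.1, inner.1.2.2⟩, inner.2.1, inner.2.2⟩)
      rw [e0] at loops
      refine ⟨loops.1.2.2.1, fun i j l h => ?_⟩
      -- A walk allowed at stage `k + 1` either avoids `k`, or has a shortcut that visits `k` once
      -- and is covered by the relaxation at `k`.
      rcases h.split (k := kk) (U := fun v => U v ∧ v.val < k)
        (fun v hv hne => ⟨hv.1, by have := Fin.val_ne_of_ne hne; simp only [hkk] at this; omega⟩)
        with h | ⟨_, p, q, hpq, hp, hq⟩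
      · exact loops.1.2.2.2 i j l h
      · have := loops.2.2 i i.2 j j.2 i j rfl rfl p q hp hq
        exact ⟨this.1, this.2.trans hpq⟩

end Cmd

end RealRAM

/-! ### The algorithm: steepest extension -/

namespace RealRAM

namespace Cmd

/-- The slope of a walk that starts with the edge from register `4` to register `5` and ends in
register `6`. -/
def slopeExp : RExp :=
  .div (.sub (.get 2 (.reg 6) (.const 0)) (.get 2 (.reg 4) (.const 0)))
    (.ofNat (.add (.get 3 (.reg 5) (.reg 6)) (.const 1)))

/-- Registers `4`, `5`, `6` hold a coloured vertex, an uncoloured neighbour of it, and a coloured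
vertex that can be reached from there. -/
def candidateTest : BExp :=
  .and (.ilt (.const 0) (.get 2 (.reg 4) (.const 0)))
    (.and (.ilt (.const 0) (.get 0 (.reg 4) (.reg 5)))
      (.and (.not (.ilt (.const 0) (.get 2 (.reg 5) (.const 0))))
        (.and (.ilt (.const 0) (.get 2 (.reg 6) (.const 0)))
          (.ilt (.const 0) (.get 3 (.reg 5) (.reg 6))))))

/-- Record the candidate in registers `4`, `5`, `6`. -/
def record : Cmd :=
  .seq (.iset 7 (.const 1)) (.seq (.iset 8 (.reg 5)) (.seq (.rset 0 slopeExp)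
    (.rset 1 (.add (.get 2 (.reg 4) (.const 0)) slopeExp))))

/-- Record the candidate in registers `4`, `5`, `6` if it is the steepest one so far. -/
def scanBody : Cmd :=
  .ite candidateTest
    (.ite (.and (.ilt (.const 0) (.reg 7)) (.not (.rlt (.reg 0) slopeExp))) .skip record) .skip

/-- The loops over all candidates. -/
def scanLoops : Cmd := .loop 4 (.loop 5 (.loop 6 scanBody))

/-- Colour the recorded vertex. -/
def colour : Cmd :=
  .ite (.ilt (.const 0) (.reg 7))
    (.seq (.iput 2 (.reg 8) (.const 0) (.const 1)) (.rput 2 (.reg 8) (.const 0) (.reg 1))) .skip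

/-- Colour one vertex on a steepest walk. -/
def extendOne : Cmd :=
  .seq initDist (.seq floydWarshall (.seq (.iset 7 (.const 0)) (.seq scanLoops colour)))

/-- Colour all vertices. -/
def extendAll : Cmd := .loop 3 extendOne

/-- `u`, `w`, `v` are as in `candidateTest`. -/
def Candidate (s : State) (u w v : ℕ) : Prop :=
  0 < s.iarr 2 u 0 ∧ 0 < s.iarr 0 u w ∧ ¬ 0 < s.iarr 2 w 0 ∧ 0 < s.iarr 2 v 0 ∧ 0 < s.iarr 3 w v

/-- The slope of a candidate. -/
noncomputable def candidateSlope (s : State) (u w v : ℕ) : ℝ :=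
  (s.rarr 2 v 0 - s.rarr 2 u 0) / ((s.iarr 3 w v + 1 : ℕ) : ℝ)

/-- Only registers have changed since `s`, and a candidate is recorded, if any. -/
def ScanState (s t : State) : Prop :=
  t.iarr = s.iarr ∧ t.rarr = s.rarr ∧ t.ireg 0 = s.ireg 0 ∧
  (0 < t.ireg 7 → ∃ u w v, u < s.ireg 0 ∧ w < s.ireg 0 ∧ v < s.ireg 0 ∧ Candidate s u w v ∧
    t.ireg 8 = w ∧ t.rreg 0 = candidateSlope s u w v ∧
    t.rreg 1 = s.rarr 2 u 0 + candidateSlope s u w v)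

/-- The recorded slope has not decreased. -/
def ScanLe (t t' : State) : Prop :=
  0 < t.ireg 7 → 0 < t'.ireg 7 ∧ t.rreg 0 ≤ t'.rreg 0

theorem ScanLe.trans {t u v : State} (h : ScanLe t u) (h' : ScanLe u v) : ScanLe t v :=
  fun h0 => ⟨(h' (h h0).1).1, (h h0).2.trans (h' (h h0).1).2⟩

/-- The candidate `u`, `w`, `v` does not beat the recorded one. -/
def Scanned (s : State) (u w v : ℕ) (t : State) : Prop :=
  Candidate s u w v → 0 < t.ireg 7 ∧ candidateSlope s u w v ≤ t.rreg 0

theorem Scanned.mono {s t t' : State} {u w v : ℕ} (hR : ScanLe t t') (h : Scanned s u w v t) :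
    Scanned s u w v t' :=
  fun hc => ⟨(hR (h hc).1).1, (h hc).2.trans (hR (h hc).1).2⟩

theorem scanBody_run {s t : State} {u w v : ℕ} (hu : u < s.ireg 0) (hw : w < s.ireg 0)
    (hv : v < s.ireg 0) (h4 : t.ireg 4 = u) (h5 : t.ireg 5 = w) (h6 : t.ireg 6 = v)
    (hV : ScanState s t) :
    ScanState s (scanBody.run t) ∧ ScanLe t (scanBody.run t) ∧
      Scanned s u w v (scanBody.run t) := by
  obtain ⟨hi, hr, h0, hrec⟩ := hV
  have hsl : slopeExp.eval t = candidateSlope s u w v := by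
    simp [slopeExp, RExp.eval, IExp.eval, candidateSlope, h4, h5, h6, hi, hr]
  have hct : candidateTest.holds t ↔ Candidate s u w v := by
    simp [candidateTest, BExp.holds, IExp.eval, Candidate, h4, h5, h6, hi]
  by_cases hc : Candidate s u w v
  · have e1 := run_ite_pos (.ite (.and (.ilt (.const 0) (.reg 7)) (.not (.rlt (.reg 0) slopeExp)))
      .skip record) .skip (hct.2 hc)
    rw [scanBody, e1]
    by_cases hb : BExp.holds t (.and (.ilt (.const 0) (.reg 7)) (.not (.rlt (.reg 0) slopeExp)))
    · rw [run_ite_pos _ _ hb]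
      simp only [BExp.holds, IExp.eval, RExp.eval, hsl, not_lt] at hb
      exact ⟨⟨hi, hr, h0, hrec⟩, fun h => ⟨h, le_rfl⟩, fun _ => hb⟩
    · rw [run_ite_neg _ _ hb]
      simp only [BExp.holds, IExp.eval, RExp.eval, hsl, not_and, not_not] at hb
      have r7 : (record.run t).ireg 7 = 1 := by simp [record, run, State.iset, State.rset, IExp.eval]
      have r8 : (record.run t).ireg 8 = w := by
        simp [record, run, State.iset, State.rset, IExp.eval, h5]
      have q0 : (record.run t).rreg 0 = candidateSlope s u w v := by
        simp [record, run, State.iset, State.rset, IExp.eval, RExp.eval, slopeExp, candidateSlope,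
          h4, h5, h6, hi, hr]
      have q1 : (record.run t).rreg 1 = s.rarr 2 u 0 + candidateSlope s u w v := by
        simp [record, run, State.iset, State.rset, IExp.eval, RExp.eval, slopeExp, candidateSlope,
          h4, h5, h6, hi, hr]
      have ha := record.run_agree t
      refine ⟨⟨?_, ?_, (ha.ireg 0 rfl).trans h0,
        fun _ => ⟨u, w, v, hu, hw, hv, hc, r8, q0, q1⟩⟩, fun h => ⟨?_, ?_⟩, fun _ => ⟨?_, q0.ge⟩⟩
      · rw [← hi]; rfl
      · rw [← hr]; rfl
      · omega
      · rw [q0]; exact (hb h).le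
      · omega
  · have e1 := run_ite_neg (.ite (.and (.ilt (.const 0) (.reg 7)) (.not (.rlt (.reg 0) slopeExp)))
      .skip record) .skip (fun h => hc (hct.1 h))
    rw [scanBody, e1]
    exact ⟨⟨hi, hr, h0, hrec⟩, fun h => ⟨h, le_rfl⟩, fun h => absurd h hc⟩

theorem scanLoops_run {s t : State} (hV : ScanState s t) :
    ScanState s (scanLoops.run t) ∧ ∀ u < s.ireg 0, ∀ w < s.ireg 0, ∀ v < s.ireg 0,
      Scanned s u w v (scanLoops.run t) := by
  have key := run_loop_cover (x := 4) (c := .loop 5 (.loop 6 scanBody)) (s := t)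
    (ScanState s) ScanLe
    (fun u t => ∀ w < s.ireg 0, ∀ v < s.ireg 0, Scanned s u w v t)
    (fun _ _ _ => ScanLe.trans) (fun _ _ h => h) (fun _ _ h => ⟨h, le_rfl⟩)
    (fun u t t' hR hK w hw v hv => (hK w hw v hv).mono hR) hV ?_
  · rw [hV.2.2.1] at key
    exact ⟨key.1, key.2.2⟩
  intro u t₁ hu _ hx₁ hV₁
  have key := run_loop_cover (x := 5) (c := .loop 6 scanBody) (s := t₁)
    (fun t => ScanState s t ∧ t.ireg 4 = u) ScanLe
    (fun w t => ∀ v < s.ireg 0, Scanned s u w v t)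
    (fun _ _ _ => ScanLe.trans) (fun _ _ h => h) (fun _ _ h => ⟨h, le_rfl⟩)
    (fun w t t' hR hK v hv => (hK v hv).mono hR) ⟨hV₁, hx₁⟩ ?_
  · rw [hV₁.2.2.1] at key
    exact ⟨key.1.1, key.2.1, key.2.2⟩
  intro w t₂ hw _ hx₂ hV₂
  have key := run_loop_cover (x := 6) (c := scanBody) (s := t₂)
    (fun t => ScanState s t ∧ t.ireg 4 = u ∧ t.ireg 5 = w) ScanLe
    (fun v t => Scanned s u w v t)
    (fun _ _ _ => ScanLe.trans) (fun _ _ h => h) (fun _ _ h => ⟨h, le_rfl⟩)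
    (fun v t t' hR hK => hK.mono hR) ⟨hV₂.1, hV₂.2, hx₂⟩ ?_
  · rw [hV₂.1.2.2.1] at key
    exact ⟨⟨key.1.1, key.1.2.1⟩, key.2.1, key.2.2⟩
  rintro v t₃ hv _ hx₃ ⟨hV₃, h4, h5⟩
  rw [hV.2.2.1] at hu
  rw [hV₁.2.2.1] at hw
  rw [hV₂.1.2.2.1] at hv
  have := scanBody_run hu hw hv h4 h5 hx₃ hV₃
  exact ⟨⟨this.1, ((scanBody.run_agree t₃).ireg 4 rfl).trans h4,
    ((scanBody.run_agree t₃).ireg 5 rfl).trans h5⟩, this.2⟩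

/-- The coloured vertices. -/
def Coloured (n : ℕ) (t : State) : Fin n → Prop := fun i => 0 < t.iarr 2 i 0

/-- The current tones. -/
def tones (n : ℕ) (t : State) : Fin n → ℝ := fun i => t.rarr 2 i 0

/-- The memory contains the graph with adjacency relation `A`. -/
def HasGraph {n : ℕ} (A : Fin n → Fin n → Prop) (t : State) : Prop :=
  t.ireg 0 = n ∧ ∀ i j : Fin n, (A i j → t.iarr 0 i j = 1) ∧ (¬ A i j → t.iarr 0 i j = 0)

/-- Maximality over recorded candidates bounds all walks: a walk of at least two edges splits off
its first edge, and its tail is no shorter than the stored distance. -/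
theorem extendOne_run {n : ℕ} {A : Fin n → Fin n → Prop} (hA : ∀ x y, A x y → A y x) {t : State}
    (hG : HasGraph A t) {x y : Fin n} (hx : Coloured n t x) (hy : ¬ Coloured n t y) (hxy : A x y) :
    ∃ u w v l a, IsSteepest A (Coloured n t) (tones n t) w u v l a ∧
      (∀ x, Coloured n (extendOne.run t) x ↔ Coloured n t x ∨ x = w) ∧
      (∀ x, Coloured n t x → tones n (extendOne.run t) x = tones n t x) ∧
      tones n (extendOne.run t) w = tones n t u + a := by
  obtain ⟨hn, hadj⟩ := hG
  set t₁ := initDist.run t with ht₁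
  have a₁ := initDist.run_agree t
  set t₂ := floydWarshall.run t₁ with ht₂
  have a₂ := floydWarshall.run_agree t₁
  set t₃ := (Cmd.iset 7 (.const 0)).run t₂ with ht₃
  set t₄ := scanLoops.run t₃ with ht₄
  have hrun : extendOne.run t = colour.run t₄ := rfl
  have hn₁ : t₁.ireg 0 = n := (a₁.ireg 0 rfl).trans hn
  have hi0 : t₂.iarr 0 = t.iarr 0 := (a₂.iarr 0 rfl).trans (a₁.iarr 0 rfl)
  have hi2 : t₂.iarr 2 = t.iarr 2 := (a₂.iarr 2 rfl).trans (a₁.iarr 2 rfl)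
  have hr2 : t₂.rarr 2 = t.rarr 2 := (a₂.rarr 2 rfl).trans (a₁.rarr 2 rfl)
  have hn₂ : t₂.ireg 0 = n := (a₂.ireg 0 rfl).trans hn₁
  have hD := floydWarshall_run A t₁ hn₁ (by
    intro i j
    rw [ht₁, initDist_run t (hn ▸ i.2) (hn ▸ j.2)]
    exact hadj i j)
  rw [← ht₂, a₁.iarr 2 rfl] at hD
  have hsc := scanLoops_run (s := t₂) (t := t₃)
    ⟨rfl, rfl, rfl, fun h => absurd h (lt_irrefl 0)⟩
  rw [← ht₄, hn₂] at hsc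
  obtain ⟨⟨hsi, hsr, -, hrec⟩, hall⟩ := hsc
  have hU : ∀ v : Fin n, t.iarr 2 v 0 = 0 ↔ ¬ Coloured n t v := by
    intro v; simp [Coloured]
  simp only [hU] at hD
  have hadj' : ∀ i j : Fin n, A i j ↔ 0 < t₂.iarr 0 i j := by
    intro i j
    rw [hi0]
    by_cases h : A i j
    · simp [h, (hadj i j).1 h]
    · simp [h, (hadj i j).2 h]
  have hcand : ∀ u w v : Fin n, Candidate t₂ u w v ↔ Coloured n t u ∧ A u w ∧ ¬ Coloured n t w ∧
      Coloured n t v ∧ 0 < t₂.iarr 3 w v := by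
    intro u w v
    simp only [Candidate, Coloured, hadj', hi2]
  have hslope : ∀ u w v : Fin n, candidateSlope t₂ u w v * (t₂.iarr 3 w v + 1) =
      tones n t v - tones n t u := by
    intro u w v
    rw [candidateSlope, hr2]
    push_cast
    exact div_mul_cancel₀ _ (by positivity)
  have hback := fun (u w : Fin n) (h : A u w) => hD.2 w u 1 (.edge (hA _ _ h))
  -- Going from `x` to `y` and back is a candidate, so the scan is never empty while a boundary edge
  -- exists.
  have hfound : 0 < t₄.ireg 7 :=
    (hall x x.2 y y.2 x x.2 ((hcand x y x).2 ⟨hx, hxy, hy, hx, (hback x y hxy).1⟩)).1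
  obtain ⟨u, w, v, hu, hw, hv, hc, h8, hq0, hq1⟩ := hrec hfound
  rw [hn₂] at hu hw hv
  lift u to Fin n using hu
  lift w to Fin n using hw
  lift v to Fin n using hv
  obtain ⟨hcu, huw, hcw, hcv, hd⟩ := (hcand u w v).1 hc
  have ha0 : 0 ≤ t₄.rreg 0 := by
    have := (hall u u.2 w w.2 u u.2 ((hcand u w u).2 ⟨hcu, huw, hcw, hcu, (hback u w huw).1⟩)).2
    simpa [candidateSlope] using this
  refine ⟨u, w, v, t₂.iarr 3 w v, t₄.rreg 0, ⟨hcu, hcw, hcv, huw, hD.1 w v hd, ?_, ?_⟩, ?_⟩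
  · intro x y l hx hy hl hw
    cases hw with
    | edge => omega
    | @cons _ m _ l h hm hw =>
      -- Replacing the distance by the longer length `l` keeps the bound, because the recorded slope
      -- is nonnegative.
      have hd' := hD.2 m y l hw
      have := (hall x x.2 m m.2 y y.2 ((hcand x m y).2 ⟨hx, h, hm, hy, hd'.1⟩)).2
      rw [← hslope x m y]
      have hle : (t₂.iarr 3 m y : ℝ) ≤ l := by exact_mod_cast hd'.2
      push_cast
      gcongr
  · rw [hq0, hslope]
  · have hcol : colour.run t₄ = (t₄.iput 2 w 0 1).rput 2 w 0 (t₄.rreg 1) := by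
      rw [colour, run_ite_pos _ _ (by simpa [BExp.holds, IExp.eval] using hfound)]
      simp [run, IExp.eval, RExp.eval, State.iput, h8]
    rw [hrun, hcol]
    refine ⟨fun x => ?_, fun x hx => ?_, ?_⟩
    · simp only [Coloured, State.rput, State.iput, hsi, ← hi2, Fin.ext_iff]
      by_cases hxw : (x : ℕ) = w <;> simp [hxw]
    · have hne : (x : ℕ) ≠ w := fun h => hcw (Fin.ext h ▸ hx)
      simp [tones, State.rput, State.iput, hsr, ← hr2, hne]
    · simp only [tones, State.rput, State.iput, and_self, if_true]
      rw [hq1, hq0, hr2]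

/-- The outer loop always performs `n` rounds; those after completion must change nothing. -/
theorem extendOne_run_of_forall {n : ℕ} {t : State} (hn : t.ireg 0 = n)
    (hall : ∀ x, Coloured n t x) :
    Coloured n (extendOne.run t) = Coloured n t ∧ tones n (extendOne.run t) = tones n t := by
  set t₁ := initDist.run t with ht₁
  have a₁ := initDist.run_agree t
  set t₂ := floydWarshall.run t₁ with ht₂
  have a₂ := floydWarshall.run_agree t₁
  set t₃ := (Cmd.iset 7 (.const 0)).run t₂ with ht₃
  set t₄ := scanLoops.run t₃ with ht₄
  have hrun : extendOne.run t = colour.run t₄ := rfl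
  have hi2 : t₂.iarr 2 = t.iarr 2 := (a₂.iarr 2 rfl).trans (a₁.iarr 2 rfl)
  have hr2 : t₂.rarr 2 = t.rarr 2 := (a₂.rarr 2 rfl).trans (a₁.rarr 2 rfl)
  have hn₂ : t₂.ireg 0 = n := (a₂.ireg 0 rfl).trans ((a₁.ireg 0 rfl).trans hn)
  have hsc := scanLoops_run (s := t₂) (t := t₃)
    ⟨rfl, rfl, rfl, fun h => absurd h (lt_irrefl 0)⟩
  rw [← ht₄, hn₂] at hsc
  obtain ⟨⟨hsi, hsr, -, hrec⟩, -⟩ := hsc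
  have h7 : ¬ 0 < t₄.ireg 7 := by
    intro h
    obtain ⟨u, w, v, -, hw, -, hc, -⟩ := hrec h
    have := hc.2.2.1
    rw [hi2] at this
    exact this (hall ⟨w, hn₂ ▸ hw⟩)
  rw [hrun, colour, run_ite_neg _ _ (by simpa [BExp.holds, IExp.eval] using h7)]
  refine ⟨?_, ?_⟩
  · funext x
    simp only [Coloured, run, hsi, hi2]
  · funext x
    simp only [tones, run, hsr, hr2]

/-- The invariant is a dichotomy: each competitor agrees with the current partial colouring or is
already `Worse`. The number of uncoloured vertices drops in every round until it is zero, so `n`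
rounds suffice. -/
theorem extendAll_run {n : ℕ} {A : Fin n → Fin n → Prop} (hA : ∀ x y, A x y → A y x) {s : State}
    (hG : HasGraph A s)
    (hconn : ∀ T : Fin n → Prop, (∀ x, Coloured n s x → T x) → (∃ y, ¬ T y) →
      ∃ x y, T x ∧ ¬ T y ∧ A x y)
    (h01 : ∀ x, Coloured n s x → tones n s x ∈ Set.Icc (0 : ℝ) 1)
    {S : Finset (Fin n × Fin n)} (hS : ∀ x y, (x, y) ∈ S ↔ A x y) :
    (∀ x, tones n (extendAll.run s) x ∈ Set.Icc (0 : ℝ) 1) ∧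
    (∀ x, Coloured n s x → tones n (extendAll.run s) x = tones n s x) ∧
    ∀ f : Fin n → ℝ, (∀ x, Coloured n s x → f x = tones n s x) →
      f = tones n (extendAll.run s) ∨ ToneLt S (tones n (extendAll.run s)) f := by
  classical
  have key := run_loop_induct (x := 3) (c := extendOne) (s := s)
    (fun m t => (∀ x, Coloured n s x → Coloured n t x ∧ tones n t x = tones n s x) ∧
      (∀ x, Coloured n t x → tones n t x ∈ Set.Icc (0 : ℝ) 1) ∧
      (∀ f : Fin n → ℝ, (∀ x, Coloured n s x → f x = tones n s x) →
        (∀ x, Coloured n t x → f x = tones n t x) ∨ Worse A (Coloured n t) (tones n t) f) ∧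
      (Finset.univ.filter fun x => ¬ Coloured n t x).card ≤ n - m) ?_ ?_
  · rw [hG.1] at key
    obtain ⟨hext, hin, hopt, hcard⟩ := key
    have hall : ∀ x, Coloured n (extendAll.run s) x := by
      intro x
      have : (Finset.univ.filter fun x => ¬ Coloured n (extendAll.run s) x).card = 0 := by
        rw [extendAll]; omega
      rw [Finset.card_eq_zero, Finset.filter_eq_empty_iff] at this
      exact not_not.1 (this (Finset.mem_univ x))
    refine ⟨fun x => hin x (hall x), fun x hx => (hext x hx).2, fun f hf => ?_⟩
    rcases hopt f hf with h | h
    · exact .inl (funext fun x => h x (hall x))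
    · exact .inr (toneLt_of_worse hA hS hall h)
  · refine ⟨fun x hx => ⟨hx, rfl⟩, h01, fun f hf => .inl hf, ?_⟩
    simpa using Finset.card_le_univ (Finset.univ.filter fun x => ¬ Coloured n (s.iset 3 0) x)
  · rintro m t hm hag hx ⟨hext, hin, hopt, hcard⟩
    change (∀ x, Coloured n s x → Coloured n (extendOne.run t) x ∧
        tones n (extendOne.run t) x = tones n s x) ∧
      (∀ x, Coloured n (extendOne.run t) x → tones n (extendOne.run t) x ∈ Set.Icc (0 : ℝ) 1) ∧
      (∀ f : Fin n → ℝ, (∀ x, Coloured n s x → f x = tones n s x) →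
        (∀ x, Coloured n (extendOne.run t) x → f x = tones n (extendOne.run t) x) ∨
          Worse A (Coloured n (extendOne.run t)) (tones n (extendOne.run t)) f) ∧
      (Finset.univ.filter fun x => ¬ Coloured n (extendOne.run t) x).card ≤ n - (m + 1)
    have hGt : HasGraph A t := by
      refine ⟨(hag.ireg 0 rfl).trans hG.1, ?_⟩
      rw [hag.iarr 0 rfl]
      exact hG.2
    by_cases hall : ∀ x, Coloured n t x
    · obtain ⟨e1, e2⟩ := extendOne_run_of_forall hGt.1 hall
      rw [e1, e2]
      refine ⟨hext, hin, hopt, ?_⟩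
      rw [Finset.card_eq_zero.2 (Finset.filter_eq_empty_iff.2 fun x _ => not_not.2 (hall x))]
      exact Nat.zero_le _
    push Not at hall
    obtain ⟨x, y, hx, hy, hxy⟩ := hconn (Coloured n t) (fun x hx => (hext x hx).1) hall
    obtain ⟨u, w, v, l, a, hst, hcol, hF, hFw⟩ := extendOne_run hA hGt hx hy hxy
    have hcol' : Coloured n (extendOne.run t) = fun x => Coloured n t x ∨ x = w :=
      funext fun x => propext (hcol x)
    refine ⟨fun x hx => ⟨(hcol x).2 (.inl (hext x hx).1), (hF x (hext x hx).1).trans (hext x hx).2⟩,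
      fun x hx => ?_, fun f hf => ?_, ?_⟩
    · by_cases hxt : Coloured n t x
      · rw [hF x hxt]
        exact hin x hxt
      · obtain rfl : x = w := ((hcol x).1 hx).resolve_left hxt
        have ha := hst.nonneg hA
        have hs := hst.slope
        have hu := hin u hst.hu
        have hv := hin v hst.hv
        -- The new tone `F u + a = F v - a * l` lies between the tones of `u` and `v`.
        have hal : 0 ≤ a * l := by positivity
        rw [hFw]
        exact ⟨by linarith [hu.1], by linarith [hv.2]⟩
    · rw [hcol']
      rcases hopt f hf with h | h
      · by_cases hfw : f w = tones n (extendOne.run t) w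
        · left
          rintro x (hx | rfl)
          · rw [h x hx, hF x hx]
          · exact hfw
        · exact .inr (hst.worse_of_ne hA hF hFw h hfw)
      · exact .inr (hst.worse_mono hA hF hFw h)
    · have hlt : (Finset.univ.filter fun x => ¬ Coloured n (extendOne.run t) x).card <
          (Finset.univ.filter fun x => ¬ Coloured n t x).card := by
        refine Finset.card_lt_card (Finset.ssubset_iff_of_subset ?_ |>.2 ⟨w, ?_, ?_⟩)
        · intro x
          simp only [Finset.mem_filter, Finset.mem_univ, true_and, hcol]
          tauto
        · simpa using hst.hw
        · simp [hcol]
      omega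

end Cmd

end RealRAM

/-! ### The algorithm: comparison of gradation vectors -/

namespace RealRAM

namespace Cmd

/-- The square of the difference of the tones in real array `a` of the vertices in registers `x`
and `y`. -/
def sqExp (a x y : ℕ) : RExp :=
  .mul (.sub (.get a (.reg x) (.const 0)) (.get a (.reg y) (.const 0)))
    (.sub (.get a (.reg x) (.const 0)) (.get a (.reg y) (.const 0)))

/-- Equality of reals. -/
def reqTest (e₁ e₂ : RExp) : BExp := .and (.not (.rlt e₁ e₂)) (.not (.rlt e₂ e₁))

/-- Equality of natural numbers. -/
def ieqTest (e₁ e₂ : IExp) : BExp := .and (.not (.ilt e₁ e₂)) (.not (.ilt e₂ e₁))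

theorem reqTest_holds (s : State) (e₁ e₂ : RExp) :
    (reqTest e₁ e₂).holds s ↔ e₁.eval s = e₂.eval s := by
  simp only [reqTest, BExp.holds, not_lt]
  exact ⟨fun h => le_antisymm h.2 h.1, fun h => ⟨h.ge, h.le⟩⟩

theorem ieqTest_holds (s : State) (e₁ e₂ : IExp) :
    (ieqTest e₁ e₂).holds s ↔ e₁.eval s = e₂.eval s := by
  simp only [ieqTest, BExp.holds, not_lt]
  exact ⟨fun h => le_antisymm h.2 h.1, fun h => ⟨h.ge, h.le⟩⟩

theorem sqExp_eval (s : State) (a x y : ℕ) :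
    (sqExp a x y).eval s = (s.rarr a (s.ireg x) 0 - s.rarr a (s.ireg y) 0) ^ 2 := by
  simp [sqExp, RExp.eval, IExp.eval, sq]

/-- Count the pair in registers `6` and `14` if its squared tone is in real register `2`. -/
def countBody : Cmd :=
  .ite (.ilt (.const 0) (.get 0 (.reg 6) (.reg 14)))
    (.seq
      (.ite (reqTest (sqExp 2 6 14) (.reg 2)) (.iset 10 (.add (.reg 10) (.const 1))) .skip)
      (.ite (reqTest (sqExp 1 6 14) (.reg 2)) (.iset 11 (.add (.reg 11) (.const 1))) .skip))
    .skip

/-- Count the pairs whose squared tone is in real register `2`, for both colourings. -/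
def countLoops : Cmd :=
  .seq (.iset 10 (.const 0)) (.seq (.iset 11 (.const 0)) (.loop 6 (.loop 14 countBody)))

open Classical in
/-- One if `i`, `j` is an adjacent pair with squared tone `c`, and zero otherwise. -/
noncomputable def toneInd (s : State) (a : ℕ) (c : ℝ) (i j : ℕ) : ℕ :=
  if 0 < s.iarr 0 i j ∧ (s.rarr a i 0 - s.rarr a j 0) ^ 2 = c then 1 else 0

theorem toneInd_congr {s t : State} (hi : t.iarr 0 = s.iarr 0) (hr : t.rarr = s.rarr) :
    toneInd t = toneInd s := by
  funext a c i j
  simp only [toneInd, hi, hr]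

theorem countBody_run (t : State) :
    (countBody.run t).ireg 10 = t.ireg 10 + toneInd t 2 (t.rreg 2) (t.ireg 6) (t.ireg 14) ∧
    (countBody.run t).ireg 11 = t.ireg 11 + toneInd t 1 (t.rreg 2) (t.ireg 6) (t.ireg 14) := by
  by_cases h0 : 0 < t.iarr 0 (t.ireg 6) (t.ireg 14)
  · rw [countBody, run_ite_pos _ _ (by simpa [BExp.holds, IExp.eval] using h0)]
    simp only [run, reqTest_holds, sqExp_eval, RExp.eval, IExp.eval, toneInd, h0, true_and]
    by_cases h1 : (t.rarr 2 (t.ireg 6) 0 - t.rarr 2 (t.ireg 14) 0) ^ 2 = t.rreg 2 <;>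
    by_cases h2 : (t.rarr 1 (t.ireg 6) 0 - t.rarr 1 (t.ireg 14) 0) ^ 2 = t.rreg 2 <;>
    simp [h1, h2, State.iset]
  · rw [countBody, run_ite_neg _ _ (by simpa [BExp.holds, IExp.eval] using h0)]
    simp [run, toneInd, h0]

theorem countLoops_run (s : State) :
    (countLoops.run s).ireg 10 =
      ∑ i ∈ Finset.range (s.ireg 0), ∑ j ∈ Finset.range (s.ireg 0), toneInd s 2 (s.rreg 2) i j ∧
    (countLoops.run s).ireg 11 =
      ∑ i ∈ Finset.range (s.ireg 0), ∑ j ∈ Finset.range (s.ireg 0),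
        toneInd s 1 (s.rreg 2) i j := by
  refine run_loop_induct (x := 6) (c := .loop 14 countBody) (s := (s.iset 10 0).iset 11 0)
    (fun m t => t.ireg 10 =
        ∑ i ∈ Finset.range m, ∑ j ∈ Finset.range (s.ireg 0), toneInd s 2 (s.rreg 2) i j ∧
      t.ireg 11 =
        ∑ i ∈ Finset.range m, ∑ j ∈ Finset.range (s.ireg 0), toneInd s 1 (s.rreg 2) i j)
    ⟨rfl, rfl⟩ ?_
  rintro m t hm hag hx ⟨h10, h11⟩
  have e0 : t.ireg 0 = s.ireg 0 := hag.ireg 0 rfl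
  have key := run_loop_induct (x := 14) (c := countBody) (s := t)
    (fun p u => u.ireg 10 = t.ireg 10 + ∑ j ∈ Finset.range p, toneInd s 2 (s.rreg 2) m j ∧
      u.ireg 11 = t.ireg 11 + ∑ j ∈ Finset.range p, toneInd s 1 (s.rreg 2) m j)
    ⟨rfl, rfl⟩ ?_
  · rw [e0] at key
    rw [Finset.sum_range_succ, Finset.sum_range_succ, ← h10, ← h11]
    exact key
  · rintro p u hp hag' hxp ⟨i10, i11⟩
    obtain ⟨c10, c11⟩ := countBody_run u
    have er : u.rarr = s.rarr := by
      funext a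
      exact (hag'.rarr a rfl).trans (hag.rarr a rfl)
    have ec : u.rreg 2 = s.rreg 2 := (hag'.rreg 2 rfl).trans (hag.rreg 2 rfl)
    rw [toneInd_congr ((hag'.iarr 0 rfl).trans (hag.iarr 0 rfl)) er, ec,
      hag'.ireg 6 rfl, hx, hxp] at c10 c11
    rw [Finset.sum_range_succ, Finset.sum_range_succ, ← add_assoc, ← add_assoc, ← i10, ← i11]
    exact ⟨c10, c11⟩

theorem sum_toneInd {n : ℕ} {A : Fin n → Fin n → Prop} {s : State} (hG : HasGraph A s)
    {S : Finset (Fin n × Fin n)} (hS : ∀ x y, (x, y) ∈ S ↔ A x y) (a : ℕ) (c : ℝ) :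
    ∑ i ∈ Finset.range (s.ireg 0), ∑ j ∈ Finset.range (s.ireg 0), toneInd s a c i j =
      toneCount S (fun i => s.rarr a i 0) c := by
  classical
  have e : S.filter (fun p => (s.rarr a p.1 0 - s.rarr a p.2 0) ^ 2 = c) =
      Finset.univ.filter fun p : Fin n × Fin n =>
        0 < s.iarr 0 p.1 p.2 ∧ (s.rarr a p.1 0 - s.rarr a p.2 0) ^ 2 = c := by
    ext ⟨x, y⟩
    have : A x y ↔ 0 < s.iarr 0 x y := by
      by_cases h : A x y
      · simp [h, (hG.2 x y).1 h]
      · simp [h, (hG.2 x y).2 h]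
    simp [hS, this]
  rw [toneCount, e, Finset.card_filter, Fintype.sum_prod_type, hG.1, Finset.sum_range]
  refine Finset.sum_congr rfl fun i _ => ?_
  rw [Finset.sum_range]
  refine Finset.sum_congr rfl fun j _ => ?_
  simp only [toneInd]

/-- Compare the multiplicities of the squared tone in real register `2`. -/
def compareAt : Cmd :=
  .seq countLoops
    (.ite (ieqTest (.reg 10) (.reg 11)) .skip
      (.ite (.and (.ilt (.const 0) (.reg 12)) (.not (.rlt (.reg 3) (.reg 2)))) .skip
        (.seq (.iset 12 (.const 1)) (.seq (.rset 3 (.reg 2))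
          (.iset 13 (.sub (.reg 11) (.reg 10)))))))

/-- Compare the multiplicities of the squared tones of the pair in registers `4` and `5`. -/
def comparePair : Cmd :=
  .ite (.ilt (.const 0) (.get 0 (.reg 4) (.reg 5)))
    (.seq (.rset 2 (sqExp 2 4 5)) (.seq compareAt (.seq (.rset 2 (sqExp 1 4 5)) compareAt)))
    .skip

/-- Register `13` becomes positive if the colouring in array `2` has the smaller gradation
vector, and zero otherwise. -/
def compareLoops : Cmd :=
  .seq (.iset 12 (.const 0)) (.seq (.iset 13 (.const 0)) (.loop 4 (.loop 5 comparePair)))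

/-- Only registers have changed since `s`, and the recorded squared tone, if any, distinguishes
the functions `N` and `O`. -/
def CompareState (N O : ℝ → ℕ) (s t : State) : Prop :=
  t.iarr = s.iarr ∧ t.rarr = s.rarr ∧ t.ireg 0 = s.ireg 0 ∧
  (0 < t.ireg 12 → N (t.rreg 3) ≠ O (t.rreg 3)) ∧
  (0 < t.ireg 12 → (0 < t.ireg 13 ↔ N (t.rreg 3) < O (t.rreg 3))) ∧
  (0 < t.ireg 13 → 0 < t.ireg 12)

/-- The recorded squared tone has not decreased. -/
def CompareLe (t t' : State) : Prop :=
  0 < t.ireg 12 → 0 < t'.ireg 12 ∧ t.rreg 3 ≤ t'.rreg 3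

theorem CompareLe.trans {t u v : State} (h : CompareLe t u) (h' : CompareLe u v) :
    CompareLe t v :=
  fun h0 => ⟨(h' (h h0).1).1, (h h0).2.trans (h' (h h0).1).2⟩

/-- The squared tone `c` has been taken into account. -/
def Compared (N O : ℝ → ℕ) (c : ℝ) (t : State) : Prop :=
  N c ≠ O c → 0 < t.ireg 12 ∧ c ≤ t.rreg 3

theorem Compared.mono {N O : ℝ → ℕ} {c : ℝ} {t t' : State} (hR : CompareLe t t')
    (h : Compared N O c t) : Compared N O c t' :=
  fun hc => ⟨(hR (h hc).1).1, (h hc).2.trans (hR (h hc).1).2⟩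

theorem compareAt_run {n : ℕ} {A : Fin n → Fin n → Prop} {s : State} (hG : HasGraph A s)
    {S : Finset (Fin n × Fin n)} (hS : ∀ x y, (x, y) ∈ S ↔ A x y) {t : State}
    (hV : CompareState (toneCount S fun i => s.rarr 2 i 0) (toneCount S fun i => s.rarr 1 i 0) s t) :
    CompareState (toneCount S fun i => s.rarr 2 i 0) (toneCount S fun i => s.rarr 1 i 0) s
      (compareAt.run t) ∧
    CompareLe t (compareAt.run t) ∧
    Compared (toneCount S fun i => s.rarr 2 i 0) (toneCount S fun i => s.rarr 1 i 0) (t.rreg 2)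
      (compareAt.run t) := by
  set N := toneCount S fun i => s.rarr 2 i 0
  set O := toneCount S fun i => s.rarr 1 i 0
  obtain ⟨hi, hr, h0, hne, hlt, hfl⟩ := hV
  set u := countLoops.run t with hu
  have ag := countLoops.run_agree t
  have hcnt := countLoops_run t
  rw [toneInd_congr (congrFun hi 0) hr, h0, sum_toneInd hG hS, sum_toneInd hG hS, ← hu] at hcnt
  obtain ⟨c10, c11⟩ := hcnt
  change u.ireg 10 = N (t.rreg 2) at c10
  change u.ireg 11 = O (t.rreg 2) at c11
  have ui : u.iarr = s.iarr := by rw [← hi]; funext a; exact ag.iarr a rfl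
  have ur : u.rarr = s.rarr := by rw [← hr]; funext a; exact ag.rarr a rfl
  have u0 : u.ireg 0 = s.ireg 0 := (ag.ireg 0 rfl).trans h0
  have u12 : u.ireg 12 = t.ireg 12 := ag.ireg 12 rfl
  have u13 : u.ireg 13 = t.ireg 13 := ag.ireg 13 rfl
  have u2 : u.rreg 2 = t.rreg 2 := ag.rreg 2 rfl
  have u3 : u.rreg 3 = t.rreg 3 := ag.rreg 3 rfl
  have hold : CompareState N O s u := by
    refine ⟨ui, ur, u0, ?_, ?_, ?_⟩ <;> simpa only [u12, u13, u3]
  have hle : CompareLe t u := fun h => by rw [u12, u3]; exact ⟨h, le_rfl⟩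
  by_cases hc : N (t.rreg 2) = O (t.rreg 2)
  · have e : compareAt.run t = u := by
      change run (.ite _ _ _) u = u
      rw [run_ite_pos _ _ ((ieqTest_holds _ _ _).2 (by simp [IExp.eval, c10, c11, hc]))]
      rfl
    rw [e]
    exact ⟨hold, hle, fun h => absurd hc h⟩
  · have e1 : compareAt.run t = run (.ite (.and (.ilt (.const 0) (.reg 12))
        (.not (.rlt (.reg 3) (.reg 2)))) .skip (.seq (.iset 12 (.const 1)) (.seq (.rset 3 (.reg 2))
          (.iset 13 (.sub (.reg 11) (.reg 10)))))) u := by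
      change run (.ite _ _ _) u = _
      rw [run_ite_neg _ _ (fun h => hc (by
        simpa [IExp.eval, c10, c11] using (ieqTest_holds _ _ _).1 h))]
    rw [e1]
    by_cases hb : BExp.holds u (.and (.ilt (.const 0) (.reg 12)) (.not (.rlt (.reg 3) (.reg 2))))
    · rw [run_ite_pos _ _ hb]
      simp only [BExp.holds, IExp.eval, RExp.eval, not_lt, u2] at hb
      exact ⟨hold, hle, fun _ => hb⟩
    · rw [run_ite_neg _ _ hb]
      simp only [BExp.holds, IExp.eval, RExp.eval, not_and, not_not, u12, u2, u3] at hb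
      set w := run (.seq (.iset 12 (.const 1)) (.seq (.rset 3 (.reg 2))
          (.iset 13 (.sub (.reg 11) (.reg 10))))) u with hw
      have w12 : w.ireg 12 = 1 := by simp [hw, run, State.iset, State.rset, IExp.eval]
      have w3 : w.rreg 3 = t.rreg 2 := by simp [hw, run, State.iset, State.rset, RExp.eval, u2]
      have w13 : w.ireg 13 = O (t.rreg 2) - N (t.rreg 2) := by
        simp [hw, run, State.iset, State.rset, IExp.eval, c10, c11]
      refine ⟨⟨ui, ur, u0, ?_, ?_, ?_⟩, fun h => ?_, fun _ => ?_⟩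
      · rw [w3]; exact fun _ => hc
      -- Register 13 holds a truncated difference, so it is positive exactly when the current
      -- colouring has the smaller multiplicity.
      · rw [w3, w13]; intro _; omega
      · omega
      · rw [w12, w3]; exact ⟨one_pos, (hb h).le⟩
      · rw [w12, w3]; exact ⟨one_pos, le_rfl⟩

/-- Multiplicities can differ only at squared tones that occur in one of the colourings. Testing
those of all adjacent pairs therefore finds the largest level of disagreement, which decides the
comparison. -/
theorem compareLoops_run {n : ℕ} {A : Fin n → Fin n → Prop} {s : State} (hG : HasGraph A s)
    {S : Finset (Fin n × Fin n)} (hS : ∀ x y, (x, y) ∈ S ↔ A x y) :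
    (0 < (compareLoops.run s).ireg 13 →
      ToneLt S (fun i => s.rarr 2 i 0) (fun i => s.rarr 1 i 0)) ∧
    (¬ 0 < (compareLoops.run s).ireg 13 →
      ToneLt S (fun i => s.rarr 1 i 0) (fun i => s.rarr 2 i 0) ∨
      ∀ c, toneCount S (fun i => s.rarr 1 i 0) c = toneCount S (fun i => s.rarr 2 i 0) c) := by
  have hadj : ∀ x y, A x y ↔ 0 < s.iarr 0 x y := by
    intro x y
    by_cases h : A x y
    · simp [h, (hG.2 x y).1 h]
    · simp [h, (hG.2 x y).2 h]
  have step := fun t => compareAt_run hG hS (t := t)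
  set N := toneCount S fun i => s.rarr 2 i 0 with hN
  set O := toneCount S fun i => s.rarr 1 i 0 with hO
  let K : ℕ → ℕ → State → Prop := fun i j t => 0 < s.iarr 0 i j →
    Compared N O ((s.rarr 2 i 0 - s.rarr 2 j 0) ^ 2) t ∧
    Compared N O ((s.rarr 1 i 0 - s.rarr 1 j 0) ^ 2) t
  have hK : ∀ i j t t', CompareLe t t' → K i j t → K i j t' :=
    fun i j t t' hR h hij => ⟨(h hij).1.mono hR, (h hij).2.mono hR⟩
  have key := run_loop_cover (x := 4) (c := .loop 5 comparePair) (s := (s.iset 12 0).iset 13 0)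
    (CompareState N O s) CompareLe (fun i t => ∀ j < s.ireg 0, K i j t)
    (fun _ _ _ => CompareLe.trans) (fun _ _ h => h) (fun _ _ h => ⟨h, le_rfl⟩)
    (fun i t t' hR h j hj => hK i j t t' hR (h j hj))
    ⟨rfl, rfl, rfl, fun h => absurd h (lt_irrefl 0), fun h => absurd h (lt_irrefl 0),
      fun h => absurd h (lt_irrefl 0)⟩ ?_
  · change CompareState N O s (compareLoops.run s) ∧ _ ∧
      ∀ i < s.ireg 0, ∀ j < s.ireg 0, K i j (compareLoops.run s) at key
    set t := compareLoops.run s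
    obtain ⟨⟨-, -, -, hne, hlt, hfl⟩, -, hall⟩ := key
    have hcov : ∀ c, N c ≠ O c → 0 < t.ireg 12 ∧ c ≤ t.rreg 3 := by
      intro c hc
      have hex : 0 < N c ∨ 0 < O c := by omega
      rcases hex with h | h
      · obtain ⟨⟨x, y⟩, hp⟩ := Finset.card_pos.1 h
        obtain ⟨hp, hpc⟩ := Finset.mem_filter.1 hp
        have := (hall x (hG.1 ▸ x.2) y (hG.1 ▸ y.2) ((hadj x y).1 ((hS x y).1 hp))).1
        simp only at hpc
        rw [hpc] at this
        exact this hc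
      · obtain ⟨⟨x, y⟩, hp⟩ := Finset.card_pos.1 h
        obtain ⟨hp, hpc⟩ := Finset.mem_filter.1 hp
        have := (hall x (hG.1 ▸ x.2) y (hG.1 ▸ y.2) ((hadj x y).1 ((hS x y).1 hp))).2
        simp only at hpc
        rw [hpc] at this
        exact this hc
    have hgt : ∀ d, t.rreg 3 < d → N d = O d := by
      intro d hd
      by_contra hcon
      exact absurd (hcov d hcon).2 (not_le.2 hd)
    refine ⟨fun h => ⟨t.rreg 3, (hlt (hfl h)).1 h, hgt⟩, fun h => ?_⟩
    by_cases h12 : 0 < t.ireg 12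
    · left
      refine ⟨t.rreg 3, ?_, fun d hd => (hgt d hd).symm⟩
      have h1 := hne h12
      have h2 := hlt h12
      change O (t.rreg 3) < N (t.rreg 3)
      omega
    · right
      intro c
      by_contra hcon
      exact h12 (hcov c (Ne.symm hcon)).1
  · intro i t hi _ hx hV
    have key := run_loop_cover (x := 5) (c := comparePair) (s := t)
      (fun t => CompareState N O s t ∧ t.ireg 4 = i) CompareLe (fun j t => K i j t)
      (fun _ _ _ => CompareLe.trans) (fun _ _ h => h) (fun _ _ h => ⟨h, le_rfl⟩)
      (fun j t t' hR h => hK i j t t' hR h) ⟨hV, hx⟩ ?_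
    · rw [hV.2.2.1] at key
      exact ⟨key.1.1, key.2.1, key.2.2⟩
    · rintro j u hj _ hxj ⟨hVu, h4⟩
      by_cases hij : 0 < s.iarr 0 i j
      · have e : comparePair.run u = compareAt.run ((compareAt.run (u.rset 2
            ((sqExp 2 4 5).eval u))).rset 2 ((sqExp 1 4 5).eval (compareAt.run (u.rset 2
            ((sqExp 2 4 5).eval u))))) := by
          rw [comparePair, run_ite_pos _ _ (by
            simp only [BExp.holds, IExp.eval, h4, hxj, hVu.1]; exact hij)]
          rfl
        rw [e]
        set u₁ := u.rset 2 ((sqExp 2 4 5).eval u) with hu₁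
        have hV₁ : CompareState N O s u₁ := hVu
        have s₁ := step u₁ hV₁
        have ag₁ := compareAt.run_agree u₁
        set u₂ := compareAt.run u₁
        have hV₂ : CompareState N O s (u₂.rset 2 ((sqExp 1 4 5).eval u₂)) := s₁.1
        have s₂ := step _ hV₂
        have ag₂ := compareAt.run_agree (u₂.rset 2 ((sqExp 1 4 5).eval u₂))
        have e4 : u₂.ireg 4 = i := (ag₁.ireg 4 rfl).trans h4
        have e5 : u₂.ireg 5 = j := (ag₁.ireg 5 rfl).trans hxj
        have q₁ : u₁.rreg 2 = (s.rarr 2 i 0 - s.rarr 2 j 0) ^ 2 := by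
          rw [← h4, ← hxj, ← hVu.2.1, ← sqExp_eval]; rfl
        have q₂ : (u₂.rset 2 ((sqExp 1 4 5).eval u₂)).rreg 2 =
            (s.rarr 1 i 0 - s.rarr 1 j 0) ^ 2 := by
          rw [← e4, ← e5, ← s₁.1.2.1, ← sqExp_eval]; rfl
        rw [q₁] at s₁
        rw [q₂] at s₂
        have hle : CompareLe u₂ (compareAt.run (u₂.rset 2 ((sqExp 1 4 5).eval u₂))) := s₂.2.1
        have hle' : CompareLe u u₂ := s₁.2.1
        exact ⟨⟨s₂.1, (ag₂.ireg 4 rfl).trans e4⟩, hle'.trans hle,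
          fun _ => ⟨s₁.2.2.mono hle, s₂.2.2⟩⟩
      · have e : comparePair.run u = u := by
          rw [comparePair, run_ite_neg _ _ (by
            simp only [BExp.holds, IExp.eval, h4, hxj, hVu.1]; exact hij)]
          rfl
        rw [e]
        exact ⟨⟨hVu, h4⟩, fun h => ⟨h, le_rfl⟩, fun h => absurd h hij⟩

end Cmd

end RealRAM

/-! ### The algorithm: choice of the black and the white vertex -/

namespace RealRAM

namespace Cmd

/-- The prescribed tones, with `0` and `1` for the vertices in registers `1` and `2`. -/
def initColour : Cmd :=
  .seq (.loop 4 (.seq (.iput 2 (.reg 4) (.const 0) (.get 1 (.reg 4) (.const 0)))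
      (.rput 2 (.reg 4) (.const 0) (.get 0 (.reg 4) (.const 0)))))
    (.seq (.seq (.iput 2 (.reg 1) (.const 0) (.const 1)) (.rput 2 (.reg 1) (.const 0) (.const 0)))
      (.seq (.iput 2 (.reg 2) (.const 0) (.const 1)) (.rput 2 (.reg 2) (.const 0) (.const 1))))

/-- Copy the current colouring to the output. -/
def copyOut : Cmd := .loop 4 (.rput 1 (.reg 4) (.const 0) (.get 2 (.reg 4) (.const 0)))

/-- Keep the better one of the current colouring and the output. -/
def select : Cmd :=
  .seq (.ite (.ilt (.const 0) (.reg 9)) compareLoops (.iset 13 (.const 1)))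
    (.ite (.ilt (.const 0) (.reg 13)) (.seq (.iset 9 (.const 1)) copyOut) .skip)

/-- Registers `1` and `2` hold distinct uncoloured vertices. -/
def pairTest : BExp :=
  .and (.and (.not (.ilt (.const 0) (.get 1 (.reg 1) (.const 0))))
    (.not (.ilt (.const 0) (.get 1 (.reg 2) (.const 0))))) (.not (ieqTest (.reg 1) (.reg 2)))

/-- Treat the pair of vertices in registers `1` and `2`. -/
def pairBody : Cmd := .ite pairTest (.seq initColour (.seq extendAll select)) .skip

/-- The whole algorithm. -/
def main : Cmd := .loop 1 (.loop 2 pairBody)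

/-- Distinctness matters: for `p = q` the tone 1 would overwrite the tone 0. -/
theorem initColour_run {n : ℕ} {t : State} (hn : t.ireg 0 = n) {p q : Fin n}
    (hp : t.ireg 1 = p) (hq : t.ireg 2 = q) (hpq : p ≠ q) :
    (∀ x : Fin n, Coloured n (initColour.run t) x ↔ 0 < t.iarr 1 x 0 ∨ x = p ∨ x = q) ∧
    (∀ x : Fin n, x ≠ p → x ≠ q → tones n (initColour.run t) x = t.rarr 0 x 0) ∧
    tones n (initColour.run t) p = 0 ∧ tones n (initColour.run t) q = 1 := by
  have key := run_loop_induct (x := 4) (s := t)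
    (c := .seq (.iput 2 (.reg 4) (.const 0) (.get 1 (.reg 4) (.const 0)))
      (.rput 2 (.reg 4) (.const 0) (.get 0 (.reg 4) (.const 0))))
    (fun m u => ∀ i < m, u.iarr 2 i 0 = t.iarr 1 i 0 ∧ u.rarr 2 i 0 = t.rarr 0 i 0)
    (fun i hi => absurd hi (by omega)) ?_
  · rw [hn] at key
    have ag := run_agree (.loop 4 (.seq (.iput 2 (.reg 4) (.const 0) (.get 1 (.reg 4) (.const 0)))
      (.rput 2 (.reg 4) (.const 0) (.get 0 (.reg 4) (.const 0))))) t
    set u := run (.loop 4 (.seq (.iput 2 (.reg 4) (.const 0) (.get 1 (.reg 4) (.const 0)))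
      (.rput 2 (.reg 4) (.const 0) (.get 0 (.reg 4) (.const 0))))) t
    have h1 : u.ireg 1 = p := (ag.ireg 1 rfl).trans hp
    have h2 : u.ireg 2 = q := (ag.ireg 2 rfl).trans hq
    have e : initColour.run t = (((u.iput 2 p 0 1).rput 2 p 0 0).iput 2 q 0 1).rput 2 q 0 1 := by
      change run (.seq (.seq (.iput 2 (.reg 1) (.const 0) (.const 1))
        (.rput 2 (.reg 1) (.const 0) (.const 0))) (.seq (.iput 2 (.reg 2) (.const 0) (.const 1))
          (.rput 2 (.reg 2) (.const 0) (.const 1)))) u = _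
      simp [run, IExp.eval, RExp.eval, State.iput, State.rput, h1, h2]
    rw [e]
    refine ⟨fun x => ?_, fun x hxp hxq => ?_, ?_, ?_⟩
    · simp only [Coloured, State.iput, State.rput, true_and, and_true, Fin.ext_iff]
      by_cases hxq : (x : ℕ) = q
      · simp [hxq]
      · by_cases hxp : (x : ℕ) = p
        · simp [hxp]
        · simp [hxp, hxq, (key x x.2).1]
    · simp only [tones, State.iput, State.rput, true_and, and_true]
      rw [Ne, Fin.ext_iff] at hxp hxq
      simp [hxp, hxq, (key x x.2).2]
    · have : (p : ℕ) ≠ q := fun h => hpq (Fin.ext h)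
      simp [tones, State.iput, State.rput, this]
    · simp [tones, State.iput, State.rput]
  · rintro m u hm hag hx ih i hi
    have e1 : u.iarr 1 = t.iarr 1 := hag.iarr 1 rfl
    have e2 : u.rarr 0 = t.rarr 0 := hag.rarr 0 rfl
    simp only [run, State.iput, State.rput, State.iset, IExp.eval, RExp.eval, hx, e1, e2, true_and,
      and_true]
    by_cases h : i = m
    · simp [h]
    · simp only [h, if_false]
      exact ih i (by omega)

theorem copyOut_run {n : ℕ} {t : State} (hn : t.ireg 0 = n) :
    output n (copyOut.run t) = tones n t := by
  have key := run_loop_induct (x := 4) (s := t)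
    (c := .rput 1 (.reg 4) (.const 0) (.get 2 (.reg 4) (.const 0)))
    (fun m u => ∀ i < m, u.rarr 1 i 0 = t.rarr 2 i 0) (fun i hi => absurd hi (by omega)) ?_
  · rw [hn] at key
    exact funext fun i => key i i.2
  · rintro m u hm hag hx ih i hi
    have e2 : u.rarr 2 = t.rarr 2 := hag.rarr 2 rfl
    simp only [run, State.rput, State.iset, IExp.eval, RExp.eval, hx, e2, true_and, and_true]
    by_cases h : i = m
    · simp [h]
    · simp only [h, if_false]
      exact ih i (by omega)

theorem select_run {n : ℕ} (G : SimpleGraph (Fin n)) [DecidableRel G.Adj] {t : State}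
    (hG : HasGraph G.Adj t) :
    0 < (select.run t).ireg 9 ∧
    (output n (select.run t) = tones n t ∨
      0 < t.ireg 9 ∧ output n (select.run t) = output n t) ∧
    gradation G (output n (select.run t)) ≤ gradation G (tones n t) ∧
    (0 < t.ireg 9 → gradation G (output n (select.run t)) ≤ gradation G (output n t)) := by
  have hcopy : ∀ u : State, u.ireg 0 = n → u.rarr = t.rarr →
      0 < (run (.seq (.iset 9 (.const 1)) copyOut) u).ireg 9 ∧
      output n (run (.seq (.iset 9 (.const 1)) copyOut) u) = tones n t := by
    intro u h0 hr
    have ag := copyOut.run_agree (u.iset 9 1)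
    refine ⟨?_, ?_⟩
    · change 0 < (copyOut.run (u.iset 9 1)).ireg 9
      rw [ag.ireg 9 rfl]
      exact one_pos
    · change output n (copyOut.run (u.iset 9 1)) = _
      rw [copyOut_run (t := u.iset 9 1) h0]
      funext i
      simp only [tones, State.iset, hr]
  by_cases h9 : 0 < t.ireg 9
  · have e : select.run t = run (.ite (.ilt (.const 0) (.reg 13))
        (.seq (.iset 9 (.const 1)) copyOut) .skip) (compareLoops.run t) := by
      change run (.ite _ _ _) (run (.ite _ _ _) t) = _
      rw [run_ite_pos compareLoops _ (by simpa [BExp.holds, IExp.eval] using h9)]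
    have ag := compareLoops.run_agree t
    obtain ⟨hlt, hge⟩ := compareLoops_run hG (mem_adjPairs G)
    set u := compareLoops.run t
    have u0 : u.ireg 0 = n := (ag.ireg 0 rfl).trans hG.1
    have ur : u.rarr = t.rarr := by funext a; exact ag.rarr a rfl
    rw [e]
    by_cases h13 : 0 < u.ireg 13
    · rw [run_ite_pos _ _ (by simpa [BExp.holds, IExp.eval] using h13)]
      obtain ⟨c9, cout⟩ := hcopy u u0 ur
      rw [cout]
      exact ⟨c9, .inl rfl, le_rfl, fun _ => (gradation_lt_of_toneLt G (hlt h13)).le⟩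
    · rw [run_ite_neg _ _ (by simpa [BExp.holds, IExp.eval] using h13)]
      have eo : output n (Cmd.skip.run u) = output n t := by
        funext i
        simp only [output, run, ur]
      rw [eo]
      refine ⟨(ag.ireg 9 rfl).symm ▸ h9, .inr ⟨h9, rfl⟩, ?_, fun _ => le_rfl⟩
      rcases hge h13 with h | h
      · exact (gradation_lt_of_toneLt G h).le
      · exact (gradation_eq_of_toneCount_eq G h).le
  -- No output exists yet; setting register 13 to 1 forces the copy.
  · have e : select.run t = run (.ite (.ilt (.const 0) (.reg 13))
        (.seq (.iset 9 (.const 1)) copyOut) .skip) (t.iset 13 1) := by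
      change run (.ite _ _ _) (run (.ite _ _ _) t) = _
      rw [run_ite_neg compareLoops _ (by simpa [BExp.holds, IExp.eval] using h9)]
      rfl
    obtain ⟨c9, cout⟩ := hcopy (t.iset 13 1) hG.1 rfl
    rw [e, run_ite_pos _ _ (by simp [BExp.holds, IExp.eval, State.iset]), cout]
    exact ⟨c9, .inl rfl, le_rfl, fun h => absurd h h9⟩

section Main

variable {n : ℕ} (G : SimpleGraph (Fin n)) [DecidableRel G.Adj] {Vc : Finset (Fin n)} (g : Vc → ℝ)

/-- The input is intact, and the output, if any, is a greyscale compatible with `g`. -/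
def MainState (t : State) : Prop :=
  t.ireg 0 = n ∧ t.iarr 0 = (input G Vc g).iarr 0 ∧ t.iarr 1 = (input G Vc g).iarr 1 ∧
  t.rarr 0 = (input G Vc g).rarr 0 ∧
  (0 < t.ireg 9 → IsGreyscale (output n t) ∧ IsCompatible g (output n t))

/-- The output has not become worse. -/
def OutputLe (t t' : State) : Prop :=
  0 < t.ireg 9 → 0 < t'.ireg 9 ∧ gradation G (output n t') ≤ gradation G (output n t)

theorem OutputLe.trans {t u v : State} (h : OutputLe G t u) (h' : OutputLe G u v) :
    OutputLe G t v :=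
  fun h0 => ⟨(h' (h h0).1).1, (h' (h h0).1).2.trans (h h0).2⟩

/-- The output is at least as good as any compatible greyscale with tone `0` at `p` and tone `1`
at `q`. -/
def PairDone (p q : ℕ) (t : State) : Prop :=
  ∀ (x y : Fin n), x.val = p → y.val = q → x ∉ Vc → y ∉ Vc → x ≠ y → 0 < t.ireg 9 ∧
    ∀ f : Fin n → ℝ, IsCompatible g f → f x = 0 → f y = 1 →
      gradation G (output n t) ≤ gradation G f

theorem PairDone.mono {p q : ℕ} {t t' : State} (hR : OutputLe G t t') (h : PairDone G g p q t) :
    PairDone G g p q t' := by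
  intro x y hx hy hxc hyc hne
  obtain ⟨h9, hle⟩ := h x y hx hy hxc hyc hne
  exact ⟨(hR h9).1, fun f hf h0 h1 => (hR h9).2.trans (hle f hf h0 h1)⟩

variable {G g}

theorem MainState.hasGraph {t : State} (h : MainState G g t) : HasGraph G.Adj t := by
  refine ⟨h.1, fun i j => ?_⟩
  rw [h.2.1]
  constructor <;> intro hij <;> simp [input, hij]

theorem MainState.iarr_one {t : State} (h : MainState G g t) (x : Fin n) :
    0 < t.iarr 1 x 0 ↔ x ∈ Vc := by
  rw [h.2.2.1]
  by_cases hx : x ∈ Vc <;> simp [input, hx]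

theorem MainState.rarr_zero {t : State} (h : MainState G g t) (x : Vc) :
    t.rarr 0 (x : Fin n) 0 = g x := by
  rw [h.2.2.2.1]
  simp [input]

/-- A competitor with tones 0 and 1 at `p` and `q` agrees with the initial colouring on all its
coloured vertices, so `extendAll_run` applies to it. Connectedness supplies the boundary edge needed
in each round. -/
theorem pairBody_run (hconn : G.Connected) (hg : ∀ u, g u ∈ Set.Icc (0 : ℝ) 1) {t : State}
    (hV : MainState G g t) {p q : ℕ} (hp : p < n) (hq : q < n) (h1 : t.ireg 1 = p)
    (h2 : t.ireg 2 = q) :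
    MainState G g (pairBody.run t) ∧ OutputLe G t (pairBody.run t) ∧
      PairDone G g p q (pairBody.run t) := by
  lift p to Fin n using hp
  lift q to Fin n using hq
  have htest : pairTest.holds t ↔ p ∉ Vc ∧ q ∉ Vc ∧ p ≠ q := by
    simp only [pairTest, BExp.holds, IExp.eval, ieqTest_holds, h1, h2, hV.iarr_one, Fin.ext_iff,
      and_assoc, Ne]
  by_cases hb : p ∉ Vc ∧ q ∉ Vc ∧ p ≠ q
  swap
  · have e : pairBody.run t = t := by
      rw [pairBody, run_ite_neg _ _ (fun h => hb (htest.1 h))]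
      rfl
    rw [e]
    refine ⟨hV, fun h => ⟨h, le_rfl⟩, fun x y hx hy hxc hyc hne => ?_⟩
    obtain rfl := Fin.ext hx
    obtain rfl := Fin.ext hy
    exact absurd ⟨hxc, hyc, hne⟩ hb
  obtain ⟨hpc, hqc, hpq⟩ := hb
  have e : pairBody.run t = select.run (extendAll.run (initColour.run t)) := by
    rw [pairBody, run_ite_pos _ _ (htest.2 ⟨hpc, hqc, hpq⟩)]
    rfl
  have a₁ := initColour.run_agree t
  obtain ⟨hcol, hto, htp, htq⟩ := initColour_run hV.1 h1 h2 hpq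
  simp only [hV.iarr_one] at hcol
  set t₁ := initColour.run t
  have a₂ := extendAll.run_agree t₁
  have hV₁ : HasGraph G.Adj t₁ := by
    refine ⟨(a₁.ireg 0 rfl).trans hV.1, ?_⟩
    rw [a₁.iarr 0 rfl]
    exact hV.hasGraph.2
  have htg : ∀ x : Vc, tones n t₁ x = g x := by
    intro x
    rw [hto x (fun h => hpc (h ▸ x.2)) (fun h => hqc (h ▸ x.2)), hV.rarr_zero]
  have hext := extendAll_run (fun _ _ h => h.symm) hV₁ (S := adjPairs G) ?_ ?_ (mem_adjPairs G)
  rotate_left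
  · rintro T hT ⟨y, hy⟩
    exact SimpleGraph.exists_adj_of_connected hconn (hT p ((hcol p).2 (.inr (.inl rfl)))) hy
  · intro x hx
    rcases (hcol x).1 hx with h | rfl | rfl
    · rw [htg ⟨x, h⟩]; exact hg _
    · simp [htp]
    · simp [htq]
  obtain ⟨hin, hpres, hopt⟩ := hext
  set t₂ := extendAll.run t₁
  have hV₂ : HasGraph G.Adj t₂ := by
    refine ⟨(a₂.ireg 0 rfl).trans hV₁.1, ?_⟩
    rw [a₂.iarr 0 rfl]
    exact hV₁.2
  have h9 : t₂.ireg 9 = t.ireg 9 := (a₂.ireg 9 rfl).trans (a₁.ireg 9 rfl)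
  have hout : output n t₂ = output n t := by
    funext i
    simp only [output, a₂.rarr 1 rfl, a₁.rarr 1 rfl]
  obtain ⟨s9, sout, sle, sle'⟩ := select_run G hV₂
  have a₃ := select.run_agree t₂
  rw [h9, hout] at sout sle'
  have hgrey : IsGreyscale (tones n t₂) :=
    ⟨hin, ⟨p, by rw [hpres p ((hcol p).2 (.inr (.inl rfl))), htp]⟩,
      ⟨q, by rw [hpres q ((hcol q).2 (.inr (.inr rfl))), htq]⟩⟩
  have hcomp : IsCompatible g (tones n t₂) := fun u => by
    rw [hpres u ((hcol u).2 (.inl u.2)), htg]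
  rw [e]
  refine ⟨⟨(a₃.ireg 0 rfl).trans hV₂.1, ?_, ?_, ?_, fun _ => ?_⟩, fun h => ⟨s9, sle' h⟩, ?_⟩
  · rw [a₃.iarr 0 rfl, a₂.iarr 0 rfl, a₁.iarr 0 rfl, hV.2.1]
  · rw [a₃.iarr 1 rfl, a₂.iarr 1 rfl, a₁.iarr 1 rfl, hV.2.2.1]
  · rw [a₃.rarr 0 rfl, a₂.rarr 0 rfl, a₁.rarr 0 rfl, hV.2.2.2.1]
  · rcases sout with h | ⟨h, h'⟩
    · rw [h]; exact ⟨hgrey, hcomp⟩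
    · rw [h']; exact hV.2.2.2.2 h
  · intro x y hx hy _ _ _
    obtain rfl := Fin.ext hx
    obtain rfl := Fin.ext hy
    refine ⟨s9, fun f hf h0 h1 => sle.trans ?_⟩
    have := hopt f (by
      intro z hz
      rcases (hcol z).1 hz with h | rfl | rfl
      · rw [htg ⟨z, h⟩]; exact hf ⟨z, h⟩
      · rw [htp, h0]
      · rw [htq, h1])
    rcases this with rfl | h
    · exact le_rfl
    · exact (gradation_lt_of_toneLt G h).le

theorem main_run (hconn : G.Connected) (hg : ∀ u, g u ∈ Set.Icc (0 : ℝ) 1) :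
    MainState G g (main.run (input G Vc g)) ∧
      ∀ p < n, ∀ q < n, PairDone G g p q (main.run (input G Vc g)) := by
  have key := run_loop_cover (x := 1) (c := .loop 2 pairBody) (s := input G Vc g)
    (MainState G g) (OutputLe G) (fun p t => ∀ q < n, PairDone G g p q t)
    (fun _ _ _ => OutputLe.trans G) (fun _ _ h => h) (fun _ _ h => ⟨h, le_rfl⟩)
    (fun p t t' hR h q hq => (h q hq).mono G g hR)
    ⟨rfl, rfl, rfl, rfl, fun h => absurd h (lt_irrefl 0)⟩ ?_
  · exact ⟨key.1, key.2.2⟩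
  · intro p t hp _ hx hV
    have key := run_loop_cover (x := 2) (c := pairBody) (s := t)
      (fun t => MainState G g t ∧ t.ireg 1 = p) (OutputLe G) (fun q t => PairDone G g p q t)
      (fun _ _ _ => OutputLe.trans G) (fun _ _ h => h) (fun _ _ h => ⟨h, le_rfl⟩)
      (fun q t t' hR h => h.mono G g hR) ⟨hV, hx⟩ ?_
    · rw [hV.1] at key
      exact ⟨key.1.1, key.2.1, key.2.2⟩
    · rintro q u hq _ hxq ⟨hVu, h1⟩
      rw [hV.1] at hq
      have := pairBody_run hconn hg hVu hp hq h1 hxq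
      exact ⟨⟨this.1, ((pairBody.run_agree u).ireg 1 rfl).trans h1⟩, this.2⟩

end Main

end Cmd

end RealRAM

theorem mainTheorem4 :
    ∃ (P : RealRAM.Prog) (C : ℕ),
      ∀ (n : ℕ) (G : SimpleGraph (Fin n)) [DecidableRel G.Adj]
        (Vc : Finset (Fin n)) (g : Vc → ℝ),
        G.Connected →
        IsIncompleteGreyscale Vc g →
        (∀ u, g u ≠ 0 ∧ g u ≠ 1) →
        2 ≤ (Finset.univ \ Vc).card →
        ∃ (t : RealRAM.State) (k : ℕ),
          RealRAM.Exec P (RealRAM.input G Vc g) t k ∧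
          k ≤ C * n ^ 6 ∧
          IsMinCompatibleGreyscale G g (RealRAM.output n t) := by
  refine ⟨RealRAM.Cmd.main.toProg, RealRAM.Cmd.main.weight, ?_⟩
  intro n G _ Vc g hconn hinc hg01 hcard
  obtain ⟨v, -⟩ := hinc.1
  -- The two `rfl` evaluate the syntactic checks on `main`. Its depth computes to 6, so `hk` is the
  -- claimed bound by definition. A vertex of `Vc` shows that `n` is positive.
  obtain ⟨k, hexec, hk⟩ := RealRAM.Cmd.exec_toProg RealRAM.Cmd.main rfl rfl
    (RealRAM.input G Vc g) (show 1 ≤ n from v.pos)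
  obtain ⟨hV, hdone⟩ := RealRAM.Cmd.main_run hconn hinc.2.2
  -- This is where `g` avoiding 0 and 1 enters: the extremes of any competitor form a pair that has
  -- been treated.
  have hunc : ∀ f : Fin n → ℝ, IsGreyscale f → IsCompatible g f →
      ∃ x y, f x = 0 ∧ f y = 1 ∧ x ∉ Vc ∧ y ∉ Vc ∧ x ≠ y := by
    rintro f ⟨-, ⟨x, hx⟩, y, hy⟩ hf
    refine ⟨x, y, hx, hy, fun h => (hg01 ⟨x, h⟩).1 ?_, fun h => (hg01 ⟨y, h⟩).2 ?_, ?_⟩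
    · rw [← hf ⟨x, h⟩, hx]
    · rw [← hf ⟨y, h⟩, hy]
    · rintro rfl
      rw [hx] at hy
      exact zero_ne_one hy
  -- Two uncoloured vertices ensure that some pair was treated, so that an output has been written.
  obtain ⟨x, hx, y, hy, hxy⟩ := Finset.one_lt_card.1 hcard
  simp only [Finset.mem_sdiff, Finset.mem_univ, true_and] at hx hy
  have h9 := (hdone x x.2 y y.2 x y rfl rfl hx hy hxy).1
  obtain ⟨hgrey, hcomp⟩ := hV.2.2.2.2 h9
  refine ⟨_, k, hexec, hk, hgrey, hcomp, fun f hf hfc => ?_⟩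
  obtain ⟨x, y, hx, hy, hxc, hyc, hxy⟩ := hunc f hf hfc
  exact (hdone x x.2 y y.2 x y rfl rfl hxc hyc hxy).2 f hfc hx hy
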